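/- A Thurston map is an orientation-preserving branched covering map $f\colon S^2\to S^2$ of degree at least $2$ whose postcritical set $\operatorname{post}(f)=\bigcup_{n\ge 1} f^n(\operatorname{crit}(f))$ is finite, where $\operatorname{crit}(f)$ is the set of points at which $f$ is not locally injective. It is called a Thurston polynomial if there is a point $p\in S^2$ with $f(p)=p$ and $f^{-1}(p)=\{p\}$. A Jordan curve $\mathcal E\subset S^2\setminus\operatorname{post}(f)$ is an equator for $f$ if (1) $\widetilde{\mathcal E}:=f^{-1}(\mathcal E)$ is connected (and hence a Jordan curve); (2) $\widetilde{\mathcal E}$ is isotopic to $\mathcal E$ rel. $\operatorname{post}(f)$, i.e. there is an isotopy $H\colon S^2\times[0,1]\to S^2$ with $H_0=\mathrm{id}$, $H_t|_{\operatorname{post}(f)}=\mathrm{id}$ for all $t$, and $H_1(\mathcal E)=\widetilde{\mathcal E}$; and (3) $H$ may be chosen so that, for an orientation of $\mathcal E$, the orientation of $\widetilde{\mathcal E}$ induced by the covering $f\colon\widetilde{\mathcal E}\to\mathcal E$ agrees with the one induced by the homeomorphism $H_1\colon\mathcal E\to\widetilde{\mathcal E}$. Proposition. Let $f\colon S^2\to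 S^2$ be a Thurston map that is not a Thurston polynomial, with $\#\operatorname{post}(f)\le 3$. Then $f$ does not have an equator. -/

import Mathlib

open scoped Topology

namespace ThurstonMap

/-- The (oriented) topological 2-sphere, modelled as the one-point compactification of `ℂ`. -/
abbrev Sphere2 : Type := OnePoint ℂ

/-- The loop `γ : ℝ → ℂ` (of period `2π`) avoids `0` and has winding number `n` around `0`:
it has a continuous logarithm that grows by `2πin` over each period. -/
def HasWindingNumber (γ : ℝ → ℂ) (n : ℤ) : Prop :=
  ∃ L : ℝ → ℂ, Continuous L ∧ (∀ t, γ t = Complex.exp (L t)) ∧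
    ∀ t, L (t + 2 * Real.pi) = L t + 2 * Real.pi * n * Complex.I

open Classical in
/-- The standard oriented local parametrization of the sphere sending `0` to `p`:
`z ↦ a + z` at a finite point `a`, and `z ↦ 1 / z` at `∞`. -/
noncomputable def stdParam : Sphere2 → ℂ → Sphere2
  | none, z => if z = 0 then OnePoint.infty else ((z⁻¹ : ℂ) : Sphere2)
  | some a, z => ((a + z : ℂ) : Sphere2)

/-- A homeomorphism `φ` from an open subset of the sphere onto an open subset of `ℂ` is
orientation-preserving: around every point `p` of its domain, small positively oriented circles
around `p` are sent to loops of winding number `1` around `φ p`. -/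
def IsOrientationPreserving (φ : OpenPartialHomeomorph Sphere2 ℂ) : Prop :=
  ∀ p ∈ φ.source, ∀ᶠ r : ℝ in 𝓝[>] 0,
    HasWindingNumber (fun t => φ (stdParam p (r * Complex.exp (t * Complex.I))) - φ p) 1

/-- An orientation-preserving branched covering map of the sphere: a continuous map that near
every point has the form `z ↦ z ^ d`, `d ≥ 1`, in orientation-preserving charts centred at the
point and at its image. (Surjectivity is automatic on the sphere.) -/
def IsBranchedCovering (f : Sphere2 → Sphere2) : Prop :=
  Continuous f ∧ ∀ p, ∃ (d : ℕ) (φ ψ : OpenPartialHomeomorph Sphere2 ℂ),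
    1 ≤ d ∧ IsOrientationPreserving φ ∧ IsOrientationPreserving ψ ∧
    p ∈ φ.source ∧ f p ∈ ψ.source ∧ φ p = 0 ∧ ψ (f p) = 0 ∧
    ∀ x ∈ φ.source, f x ∈ ψ.source ∧ ψ (f x) = φ x ^ d

/-- The degree of a branched covering map: the number of preimages of a generic point, that is,
the largest number of preimages of a point. -/
noncomputable def degree (f : Sphere2 → Sphere2) : ℕ∞ :=
  ⨆ y, (f ⁻¹' {y}).encard

/-- The critical points of `f`: the points near which `f` is not injective. -/
def criticalSet (f : Sphere2 → Sphere2) : Set Sphere2 :=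
  {c | ∀ U ∈ 𝓝 c, ¬ Set.InjOn f U}

/-- The postcritical set: the union of the forward images `f^n(crit f)`, `n ≥ 1`. -/
def postcriticalSet (f : Sphere2 → Sphere2) : Set Sphere2 :=
  ⋃ (n : ℕ) (_ : 1 ≤ n), f^[n] '' criticalSet f

/-- A Thurston map: an orientation-preserving, postcritically finite branched covering map
`S² → S²` of degree at least `2`. -/
structure IsThurstonMap (f : Sphere2 → Sphere2) : Prop where
  isBranchedCovering : IsBranchedCovering f
  two_le_degree : 2 ≤ degree f
  finite_postcriticalSet : (postcriticalSet f).Finite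

/-- A Thurston polynomial: a Thurston map with a totally invariant point. -/
def IsThurstonPolynomial (f : Sphere2 → Sphere2) : Prop :=
  IsThurstonMap f ∧ ∃ p, f p = p ∧ f ⁻¹' {p} = {p}

/-- `H` is an isotopy of the sphere rel. `P` that starts at the identity. -/
def IsIsotopyRel (H : unitInterval → Sphere2 ≃ₜ Sphere2) (P : Set Sphere2) : Prop :=
  Continuous (fun x : unitInterval × Sphere2 => H x.1 x.2) ∧
    (∀ x, H 0 x = x) ∧ ∀ t, ∀ p ∈ P, H t p = p

/-- For a Jordan curve parametrized by `γ`, the map `g` sends the curve to itself and is an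
orientation-preserving covering of it: read on the circle through `γ`, it lifts to a
strictly increasing continuous map of `ℝ`. (In particular this does not depend on the
orientation chosen on the curve.) -/
def PreservesCurveOrientation (γ : Circle → Sphere2) (g : Sphere2 → Sphere2) : Prop :=
  ∃ θ : ℝ → ℝ, Continuous θ ∧ StrictMono θ ∧
    ∀ t, g (γ (Circle.exp t)) = γ (Circle.exp (θ t))

/-- The set `E` is an equator for `f`: it is a Jordan curve (parametrized by `γ`) in the complement
of the postcritical set, its preimage `f⁻¹(E)` is connected, and some isotopy `H` rel. the
postcritical set deforms `E` to `f⁻¹(E)` in such a way that the orientations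
induced on `f⁻¹(E)` by `f : f⁻¹(E) → E` and by `H₁ : E → f⁻¹(E)` agree, i.e. such that
`f ∘ H₁ : E → E` preserves orientation. -/
def IsEquator (f : Sphere2 → Sphere2) (E : Set Sphere2) : Prop :=
  ∃ γ : Circle → Sphere2, Continuous γ ∧ Function.Injective γ ∧ Set.range γ = E ∧
    Disjoint E (postcriticalSet f) ∧ IsConnected (f ⁻¹' E) ∧
    ∃ H : unitInterval → Sphere2 ≃ₜ Sphere2, IsIsotopyRel H (postcriticalSet f) ∧
      H 1 '' E = f ⁻¹' E ∧ PreservesCurveOrientation γ (fun x => f (H 1 x))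

/-- `f` has an equator. -/
def HasEquator (f : Sphere2 → Sphere2) : Prop :=
  ∃ E, IsEquator f E

end ThurstonMap

/-!
For a closed curve `γ` in the sphere and two points `p`, `q` off it, `index γ p q` is the winding
number of `γ` around `p` in a coordinate that sends `p` to `0` and `q` to `∞`. A Jordan curve has
two sides, and its index is `1` or `-1` for a pair of points on different sides and `0` for a pair
on the same side.

Let `γ` be an equator of `f` and `δ` its isotopic preimage. If a side of `γ` contains a single
postcritical point `p`, then `f` is a covering over the side punctured at `p`. As `δ` covers `γ` and
is connected, the preimages of the punctured side that end at the various preimages of `p` all meet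
along `δ` and so coincide: `p` has only one preimage `x`. The isotopy fixes the indices of pairs of
postcritical points, and branched coverings and the map `δ → γ` preserve orientation, so `x` lies on
the same side of `δ` as `p`. Hence `f p` is a postcritical point on the side of `p`, thus `f p = p`,
and `f` is a Thurston polynomial. Otherwise each side contains at least two postcritical points.
-/

namespace ThurstonMap

open Complex Filter

theorem exists_int_of_exp_eq {X : Type*} [TopologicalSpace X] {s : Set X} (hs : IsPreconnected s)
    {A B : X → ℂ} (hA : ContinuousOn A s) (hB : ContinuousOn B s)
    (h : ∀ x ∈ s, exp (A x) = exp (B x)) :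
    ∃ n : ℤ, ∀ x ∈ s, A x = B x + 2 * Real.pi * n * I := by
  rcases s.eq_empty_or_nonempty with rfl | ⟨x₀, hx₀⟩
  · exact ⟨0, by simp⟩
  have hconst : ∀ x ∈ s, A x - B x = A x₀ - B x₀ := fun x hx =>
    isCoveringMap_exp.constOn_of_comp hs (hA.sub hB)
      (fun a ha b hb => by simp [Complex.exp_sub, h a ha, h b hb]) hx hx₀
  obtain ⟨n, hn⟩ := exp_eq_exp_iff_exists_int.1 (h x₀ hx₀)
  exact ⟨n, fun x hx => by linear_combination hconst x hx + hn⟩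

theorem exists_int_of_exp_eq_of_continuous {X : Type*} [TopologicalSpace X] [PreconnectedSpace X]
    {A B : X → ℂ} (hA : Continuous A) (hB : Continuous B) (h : ∀ x, exp (A x) = exp (B x)) :
    ∃ n : ℤ, ∀ x, A x = B x + 2 * Real.pi * n * I := by
  simpa using exists_int_of_exp_eq isPreconnected_univ hA.continuousOn hB.continuousOn
    (fun x _ => h x)

theorem two_pi_mul_int_mul_I_injective {m n : ℤ}
    (h : (2 * Real.pi * m * I : ℂ) = 2 * Real.pi * n * I) : m = n := by
  simpa [Real.pi_ne_zero, I_ne_zero] using h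

theorem exists_log_homotopy {X : Type*} [TopologicalSpace X] {F : unitInterval × X → ℂ}
    (hF : Continuous F) (h0 : ∀ x, F x ≠ 0) (h1 : ∀ x, F (0, x) = 1) :
    ∃ L : unitInterval × X → ℂ, Continuous L ∧ (∀ x, F x = exp (L x)) ∧ ∀ x, L (0, x) = 0 := by
  let H : C(unitInterval × X, {z : ℂ // z ≠ 0}) := ⟨fun x => ⟨F x, h0 x⟩, by fun_prop⟩
  have H0 : ∀ a, H (0, a) = (fun z : ℂ => (⟨_, z.exp_ne_zero⟩ : {z : ℂ // z ≠ 0}))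
      ((0 : C(X, ℂ)) a) := fun a => Subtype.ext (by simp [H, h1])
  have hlift := isCoveringMap_exp.liftHomotopy_lifts H 0 H0
  exact ⟨isCoveringMap_exp.liftHomotopy H 0 H0, map_continuous _,
    fun x => (congrArg Subtype.val (congrFun hlift x)).symm,
    isCoveringMap_exp.liftHomotopy_zero H 0 H0⟩

theorem exists_log_of_convex {E : Type*} [NormedAddCommGroup E] [NormedSpace ℝ E] {s : Set E}
    (hs : Convex ℝ s) {h : E → ℂ} (hh : ContinuousOn h s) (h0 : ∀ x ∈ s, h x ≠ 0) :
    ∃ L : E → ℂ, ContinuousOn L s ∧ ∀ x ∈ s, h x = exp (L x) := by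
  classical
  rcases s.eq_empty_or_nonempty with rfl | ⟨x₀, hx₀⟩
  · exact ⟨0, by simp, by simp⟩
  have hmem : ∀ y : unitInterval × s, x₀ + (y.1 : ℝ) • ((y.2 : E) - x₀) ∈ s := fun y =>
    hs.add_smul_sub_mem hx₀ y.2.2 y.1.2
  let F : unitInterval × s → ℂ := fun y => h (x₀ + (y.1 : ℝ) • ((y.2 : E) - x₀)) / h x₀
  have hF : Continuous F := (hh.comp_continuous (by fun_prop) hmem).div_const _
  obtain ⟨L, hL, hFL, -⟩ := exists_log_homotopy hF
    (fun y => div_ne_zero (h0 _ (hmem y)) (h0 _ hx₀)) (fun y => by simp [F, h0 _ hx₀])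
  refine ⟨fun x => if hx : x ∈ s then L (1, ⟨x, hx⟩) + log (h x₀) else 0, ?_, fun x hx => ?_⟩
  · rw [continuousOn_iff_continuous_domRestrict]
    have : Continuous fun x : s => L (1, x) + log (h x₀) := by fun_prop
    convert this using 2 with x
    simp
  · have hquot : h x / h x₀ = exp (L (1, ⟨x, hx⟩)) := by simpa [F] using hFL (1, ⟨x, hx⟩)
    simp only [hx, dif_pos, Complex.exp_add, ← hquot, exp_log (h0 _ hx₀),
      div_mul_cancel₀ _ (h0 _ hx₀)]

theorem exists_log {E : Type*} [NormedAddCommGroup E] [NormedSpace ℝ E] {h : E → ℂ}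
    (hh : Continuous h) (h0 : ∀ x, h x ≠ 0) :
    ∃ L : E → ℂ, Continuous L ∧ ∀ x, h x = exp (L x) := by
  simpa using exists_log_of_convex convex_univ hh.continuousOn (fun x _ => h0 x)

theorem hasWindingNumber_const {c : ℂ} (hc : c ≠ 0) : HasWindingNumber (fun _ => c) 0 :=
  ⟨fun _ => log c, continuous_const, fun _ => (exp_log hc).symm, by simp⟩

theorem hasWindingNumber_exp : HasWindingNumber (fun t => exp (t * I)) 1 :=
  ⟨fun t => t * I, by fun_prop, fun _ => rfl, fun t => by push_cast; ring⟩

theorem exists_hasWindingNumber {γ : ℝ → ℂ} (hγ : Continuous γ) (h0 : ∀ t, γ t ≠ 0)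
    (hp : Function.Periodic γ (2 * Real.pi)) : ∃ n, HasWindingNumber γ n := by
  obtain ⟨L, hL, h⟩ := exists_log hγ h0
  obtain ⟨n, hn⟩ := exists_int_of_exp_eq_of_continuous (A := fun t => L (t + 2 * Real.pi))
    (by fun_prop) hL fun t => by rw [← h, ← h, hp]
  exact ⟨n, L, hL, h, hn⟩

theorem hasWindingNumber_zero_of_norm_sub_one_lt {c : ℝ → ℂ} (hc : Continuous c)
    (hp : Function.Periodic c (2 * Real.pi)) (h : ∀ t, ‖c t - 1‖ < 1) : HasWindingNumber c 0 := by
  have hs : ∀ t, c t ∈ slitPlane := fun t => by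
    simpa using mem_slitPlane_of_norm_lt_one (h t)
  exact ⟨fun t => log (c t), hc.clog hs, fun t => (exp_log (slitPlane_ne_zero (hs t))).symm,
    fun t => by simp [hp t]⟩

theorem hasWindingNumber_comp_of_ne_zero {h : ℂ → ℂ} (hh : Continuous h) (h0 : ∀ w, h w ≠ 0)
    {a : ℝ → ℂ} (ha : Continuous a) (hp : Function.Periodic a (2 * Real.pi)) :
    HasWindingNumber (fun t => h (a t)) 0 := by
  obtain ⟨L, hL, hhL⟩ := exists_log hh h0
  exact ⟨fun t => L (a t), hL.comp ha, fun t => hhL _, fun t => by simp [hp t]⟩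

theorem add_int_mul_two_pi {L : ℝ → ℂ} {n : ℤ}
    (hL : ∀ t, L (t + 2 * Real.pi) = L t + 2 * Real.pi * n * I) (m : ℤ) (t : ℝ) :
    L (t + m * (2 * Real.pi)) = L t + 2 * Real.pi * (m * n : ℤ) * I := by
  have hper : Function.Periodic (fun t : ℝ => L t - n * t * I) (2 * Real.pi) := fun t => by
    simp only [hL]; push_cast; ring
  have hshift := hper.int_mul m t
  push_cast at hshift ⊢
  linear_combination hshift

namespace HasWindingNumber

variable {γ δ : ℝ → ℂ} {m n : ℤ}

theorem log_add_two_pi (h : HasWindingNumber γ n) {L : ℝ → ℂ} (hL : Continuous L)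
    (hγ : ∀ t, γ t = exp (L t)) (t : ℝ) : L (t + 2 * Real.pi) = L t + 2 * Real.pi * n * I := by
  obtain ⟨M, hM, hγM, hn⟩ := h
  obtain ⟨k, hk⟩ := exists_int_of_exp_eq_of_continuous hL hM fun t => by rw [← hγ, ← hγM]
  rw [hk, hk, hn]; ring

theorem unique (hm : HasWindingNumber γ m) (hn : HasWindingNumber γ n) : m = n := by
  obtain ⟨L, hL, h, hi⟩ := hm
  have h0 := hn.log_add_two_pi hL h 0
  rw [hi 0] at h0
  exact two_pi_mul_int_mul_I_injective (add_left_cancel h0)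

theorem mul (hm : HasWindingNumber γ m) (hn : HasWindingNumber δ n) :
    HasWindingNumber (fun t => γ t * δ t) (m + n) := by
  obtain ⟨L, hL, h, hi⟩ := hm
  obtain ⟨M, hM, h', hi'⟩ := hn
  refine ⟨fun t => L t + M t, hL.add hM, fun t => ?_, fun t => ?_⟩
  · simp only [Complex.exp_add, h, h']
  · simp only [hi, hi']; push_cast; ring

theorem zpow (hm : HasWindingNumber γ m) (k : ℤ) :
    HasWindingNumber (fun t => γ t ^ k) (k * m) := by
  obtain ⟨L, hL, h, hi⟩ := hm
  refine ⟨fun t => k * L t, continuous_const.mul hL, fun t => ?_, fun t => ?_⟩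
  · simp only [exp_int_mul, h]
  · simp only [hi]; push_cast; ring

theorem comp (hn : HasWindingNumber γ n) {θ : ℝ → ℝ} (hθ : Continuous θ)
    (hm : ∀ t, θ (t + 2 * Real.pi) = θ t + m * (2 * Real.pi)) :
    HasWindingNumber (fun t => γ (θ t)) (m * n) := by
  obtain ⟨L, hL, h, hi⟩ := hn
  exact ⟨fun t => L (θ t), hL.comp hθ, fun t => h _, fun t => by
    simp only [hm, add_int_mul_two_pi hi]⟩

theorem homotopy {F : unitInterval → ℝ → ℂ} (hF : Continuous (Function.uncurry F))
    (h0 : ∀ τ t, F τ t ≠ 0) (hp : ∀ τ, Function.Periodic (F τ) (2 * Real.pi))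
    (h : HasWindingNumber (F 0) n) : HasWindingNumber (F 1) n := by
  obtain ⟨L, hL, hFL, hi⟩ := h
  have hF0 : Continuous fun x : unitInterval × ℝ => F 0 x.2 :=
    hF.comp (f := fun x : unitInterval × ℝ => ((0 : unitInterval), x.2)) (by fun_prop)
  obtain ⟨M, hM, hFM, hM0⟩ := exists_log_homotopy
    (F := fun x : unitInterval × ℝ => F x.1 x.2 / F 0 x.2) (hF.div hF0 fun x => h0 _ _)
    (fun x => div_ne_zero (h0 _ _) (h0 _ _)) (fun x => div_self (h0 _ _))
  have hexp : ∀ τ t, F τ t = exp (M (τ, t) + L t) := fun τ t => by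
    rw [Complex.exp_add, ← hFM, ← hFL]; exact (div_mul_cancel₀ _ (h0 _ _)).symm
  obtain ⟨k, hk⟩ := exists_int_of_exp_eq_of_continuous
    (A := fun x : unitInterval × ℝ => M (x.1, x.2 + 2 * Real.pi) + L (x.2 + 2 * Real.pi))
    (B := fun x : unitInterval × ℝ => M x + L x.2) (by fun_prop) (by fun_prop)
    (fun x => by rw [← hexp, ← hexp, hp])
  have hkn : k = n := by
    have hk0 := hk (0, 0)
    simp only [hM0, hi] at hk0
    exact two_pi_mul_int_mul_I_injective (by linear_combination -hk0)
  subst hkn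
  exact ⟨fun t => M (1, t) + L t, by fun_prop, hexp 1, fun t => hk (1, t)⟩

end HasWindingNumber

theorem exp_add_two_pi_mul_int_mul_I (s : ℂ) (n : ℤ) : exp (s + 2 * Real.pi * n * I) = exp s :=
  exp_eq_exp_iff_exists_int.2 ⟨n, by ring⟩

theorem continuousOn_comp_log {S : Set ℂ} {Λ : ℂ → ℂ} (hΛ : ContinuousOn Λ (exp ⁻¹' S))
    (hp : Function.Periodic Λ (2 * Real.pi * I)) :
    ContinuousOn (fun w => Λ (log w)) (S \ {0}) := by
  rintro w₀ ⟨hw₀S, hw₀⟩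
  set σ : ℂ → ℂ := fun w => log (w / w₀) + log w₀
  have hexp : ∀ w ≠ 0, exp (σ w) = w := fun w hw => by
    rw [Complex.exp_add, exp_log (div_ne_zero hw hw₀), exp_log hw₀, div_mul_cancel₀ _ hw₀]
  have heq : ∀ w ≠ 0, Λ (log w) = Λ (σ w) := fun w hw => by
    obtain ⟨n, hn⟩ := exp_eq_exp_iff_exists_int.1 ((exp_log hw).trans (hexp w hw).symm)
    rw [hn]
    exact hp.int_mul n _
  have hσ : ContinuousAt σ w₀ := by
    have : w₀ / w₀ ∈ slitPlane := by simp [div_self hw₀]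
    exact ((continuousAt_id.div_const w₀).clog this).add continuousAt_const
  refine ContinuousWithinAt.congr ?_ (fun w hw => heq w hw.2) (heq w₀ hw₀)
  refine (hΛ (σ w₀) ?_).comp hσ.continuousWithinAt fun w hw => ?_
  · rwa [Set.mem_preimage, hexp w₀ hw₀]
  · rw [Set.mem_preimage, hexp w hw.2]
    exact hw.1

theorem exists_eq_zpow_mul_exp {S : Set ℂ} (hS : Convex ℝ (exp ⁻¹' S)) {h : ℂ → ℂ}
    (hh : ContinuousOn h (S \ {0})) (h0 : ∀ w ∈ S \ {0}, h w ≠ 0) :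
    ∃ (n : ℤ) (ℓ : ℂ → ℂ), ContinuousOn ℓ (S \ {0}) ∧ ∀ w ∈ S \ {0}, h w = w ^ n * exp (ℓ w) := by
  set T := exp ⁻¹' S
  have hper : Function.Periodic exp (2 * Real.pi * I) := exp_periodic
  have hT : ∀ s, s + 2 * Real.pi * I ∈ T ↔ s ∈ T := fun s => by
    simp only [T, Set.mem_preimage, hper s]
  have hmaps : Set.MapsTo exp T (S \ {0}) := fun s hs => ⟨hs, exp_ne_zero s⟩
  obtain ⟨L, hL, hhL⟩ := exists_log_of_convex hS (hh.comp continuous_exp.continuousOn hmaps)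
    fun s hs => h0 _ (hmaps hs)
  obtain ⟨n, hn⟩ := exists_int_of_exp_eq hS.isPreconnected (A := fun s => L (s + 2 * Real.pi * I))
    (hL.comp (by fun_prop) fun s hs => (hT s).2 hs) hL fun s hs => by
      rw [← hhL s hs, ← hhL _ ((hT s).2 hs), Function.comp_apply, Function.comp_apply, hper s]
  set Λ : ℂ → ℂ := T.indicator fun s => L s - n * s
  have hΛ : ContinuousOn Λ T :=
    (hL.sub (by fun_prop)).congr fun s hs => Set.indicator_of_mem hs _
  have hΛp : Function.Periodic Λ (2 * Real.pi * I) := fun s => by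
    by_cases hs : s ∈ T
    · simp only [Λ, Set.indicator_of_mem hs, Set.indicator_of_mem ((hT s).2 hs), hn s hs]
      ring
    · simp only [Λ, Set.indicator_of_notMem hs, Set.indicator_of_notMem (mt (hT s).1 hs)]
  refine ⟨n, fun w => Λ (log w), continuousOn_comp_log hΛ hΛp, fun w hw => ?_⟩
  have hlog : log w ∈ T := by simpa only [T, Set.mem_preimage, exp_log hw.2] using hw.1
  calc h w = exp (n * log w + Λ (log w)) := by
        simp only [Λ, Set.indicator_of_mem hlog, add_sub_cancel, ← hhL _ hlog,
          Function.comp_apply, exp_log hw.2]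
    _ = w ^ n * exp (Λ (log w)) := by rw [Complex.exp_add, exp_int_mul, exp_log hw.2]

/-- The local degree of `g` at `0`, for `g` without zeros in a punctured neighbourhood of `0`:
there `g w / w ^ d` has a continuous logarithm. -/
def HasLocalDegree (g : ℂ → ℂ) (d : ℤ) : Prop :=
  ∃ ℓ : ℂ → ℂ, ∀ᶠ w in 𝓝[≠] 0, ContinuousAt ℓ w ∧ g w = w ^ d * exp (ℓ w)

theorem hasLocalDegree_id_mul {u : ℂ → ℂ} (hu : ∀ᶠ w in 𝓝 0, ContinuousAt u w) (h0 : u 0 ≠ 0) :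
    HasLocalDegree (fun w => w * u w) 1 := by
  set v : ℂ → ℂ := fun w => u w / u 0
  have hv0 : v 0 = 1 := div_self h0
  have hv : ∀ᶠ w in 𝓝 0, ContinuousAt v w := hu.mono fun w hw => hw.div_const _
  have hslit : ∀ᶠ w in 𝓝 0, v w ∈ slitPlane :=
    hv.self_of_nhds.eventually (isOpen_slitPlane.mem_nhds (by simp [hv0]))
  refine ⟨fun w => log (v w) + log (u 0), eventually_nhdsWithin_of_eventually_nhds ?_⟩
  filter_upwards [hv, hslit] with w hw hws
  refine ⟨(hw.clog hws).add continuousAt_const, ?_⟩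
  rw [Complex.exp_add, exp_log (slitPlane_ne_zero hws), exp_log h0, zpow_one,
    div_mul_cancel₀ _ h0]

theorem exists_hasLocalDegree {g : ℂ → ℂ} (hg : ∀ᶠ w in 𝓝[≠] 0, ContinuousAt g w ∧ g w ≠ 0) :
    ∃ d, HasLocalDegree g d := by
  obtain ⟨R, hR, hball⟩ := Metric.mem_nhdsWithin_iff.1 hg
  have hconv : Convex ℝ (exp ⁻¹' Metric.ball 0 R) := by
    have : exp ⁻¹' Metric.ball 0 R = reLm ⁻¹' Set.Iio (Real.log R) := by
      ext s
      simp [norm_exp, Real.lt_log_iff_exp_lt hR]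
    exact this ▸ (convex_Iio (Real.log R)).linear_preimage reLm
  obtain ⟨d, ℓ, hℓ, hgℓ⟩ := exists_eq_zpow_mul_exp hconv
    (fun w hw => (hball hw).1.continuousWithinAt) fun w hw => (hball hw).2
  refine ⟨d, ℓ, mem_of_superset (sdiff_mem_nhdsWithin_compl (Metric.ball_mem_nhds 0 hR) {0})
    fun w hw => ⟨hℓ.continuousAt ?_, hgℓ w hw⟩⟩
  exact (Metric.isOpen_ball.sdiff isClosed_singleton).mem_nhds hw

namespace HasLocalDegree

variable {g h : ℂ → ℂ} {d e : ℤ}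

theorem eventually_hasWindingNumber (hg : HasLocalDegree g d) :
    ∀ᶠ r : ℝ in 𝓝[>] 0, HasWindingNumber (fun t => g (r * exp (t * I))) d := by
  obtain ⟨ℓ, hℓ⟩ := hg
  obtain ⟨R, hR, hball⟩ := Metric.mem_nhdsWithin_iff.1 hℓ
  filter_upwards [Ioo_mem_nhdsGT hR] with r hr
  have hcircle : ∀ t : ℝ, (r * exp (t * I) : ℂ) ∈ Metric.ball 0 R ∩ {0}ᶜ := fun t => by
    simp [norm_exp_ofReal_mul_I, abs_of_pos hr.1, hr.2, hr.1.ne']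
  refine ⟨fun t => d * (log r + t * I) + ℓ (r * exp (t * I)), ?_, fun t => ?_, fun t => ?_⟩
  · refine Continuous.add (by fun_prop) (continuous_iff_continuousAt.2 fun t => ?_)
    exact (hball (hcircle t)).1.comp (f := fun t : ℝ => (r * exp (t * I) : ℂ)) (by fun_prop)
  · beta_reduce
    rw [(hball (hcircle t)).2, Complex.exp_add, exp_int_mul, Complex.exp_add,
      exp_log (ofReal_ne_zero.2 hr.1.ne')]
  · have : exp ((t + 2 * Real.pi : ℝ) * I) = exp (t * I) := by
      rw [← exp_add_two_pi_mul_int_mul_I (t * I) 1]; push_cast; ring_nf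
    simp only [this]; push_cast; ring

theorem unique (hd : HasLocalDegree g d) (he : HasLocalDegree g e) : d = e := by
  obtain ⟨r, hrd, hre⟩ :=
    (hd.eventually_hasWindingNumber.and he.eventually_hasWindingNumber).exists
  exact hrd.unique hre

theorem congr (hg : HasLocalDegree g d) (hgh : g =ᶠ[𝓝[≠] 0] h) : HasLocalDegree h d := by
  obtain ⟨ℓ, hℓ⟩ := hg
  refine ⟨ℓ, ?_⟩
  filter_upwards [hℓ, hgh] with w hw hghw
  rwa [← hghw]

theorem pow (hg : HasLocalDegree g d) (k : ℕ) : HasLocalDegree (fun w => g w ^ k) (k * d) := by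
  obtain ⟨ℓ, hℓ⟩ := hg
  refine ⟨fun w => k * ℓ w, hℓ.mono fun w hw => ⟨continuousAt_const.mul hw.1, ?_⟩⟩
  simp only [hw.2]
  rw [mul_pow, ← exp_nat_mul, mul_comm (k : ℤ), zpow_mul, zpow_natCast]

theorem comp (hh : HasLocalDegree h d) (hg : HasLocalDegree g e)
    (hgc : ∀ᶠ w in 𝓝[≠] 0, ContinuousAt g w) (hg0 : Tendsto g (𝓝[≠] 0) (𝓝[≠] 0)) :
    HasLocalDegree (fun w => h (g w)) (d * e) := by
  obtain ⟨ℓ, hℓ⟩ := hg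
  obtain ⟨m, hm⟩ := hh
  refine ⟨fun w => d * ℓ w + m (g w), ?_⟩
  filter_upwards [hℓ, hgc, hg0.eventually hm] with w hw hwc hwm
  refine ⟨(continuousAt_const.mul hw.1).add (hwm.1.comp hwc), ?_⟩
  rw [hwm.2, Complex.exp_add, exp_int_mul, ← mul_assoc]
  nth_rewrite 1 [hw.2]
  rw [mul_zpow, mul_comm d, zpow_mul]

theorem of_comp_left (hh : HasLocalDegree h 1) (hhg : HasLocalDegree (fun w => h (g w)) d)
    (hgc : ∀ᶠ w in 𝓝[≠] 0, ContinuousAt g w) (hg0 : Tendsto g (𝓝[≠] 0) (𝓝[≠] 0)) :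
    HasLocalDegree g d := by
  obtain ⟨ℓ, hℓ⟩ := hhg
  obtain ⟨m, hm⟩ := hh
  refine ⟨fun w => ℓ w - m (g w), ?_⟩
  filter_upwards [hℓ, hgc, hg0.eventually hm] with w hw hwc hwm
  refine ⟨hw.1.sub (hwm.1.comp hwc), ?_⟩
  rw [Complex.exp_sub, ← mul_div_assoc, ← hw.2, hwm.2, zpow_one,
    mul_div_cancel_right₀ _ (exp_ne_zero _)]

theorem hasWindingNumber_comp (hh : HasLocalDegree h d) (hc : ContinuousOn h {0}ᶜ)
    (h0 : ∀ w ≠ 0, h w ≠ 0) {a : ℝ → ℂ} {n : ℤ} (ha : HasWindingNumber a n) :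
    HasWindingNumber (fun t => h (a t)) (d * n) := by
  obtain ⟨d', ℓ, hℓ, hhℓ⟩ := exists_eq_zpow_mul_exp (S := Set.univ) (by simp [convex_univ])
    (hc.mono fun w hw => hw.2) fun w hw => h0 w hw.2
  have hmem : ∀ w ≠ 0, w ∈ (Set.univ \ {0} : Set ℂ) := fun w hw => ⟨trivial, hw⟩
  have hloc : HasLocalDegree h d' := ⟨ℓ, eventually_nhdsWithin_of_forall fun w hw =>
    ⟨hℓ.continuousAt ((isOpen_univ.sdiff isClosed_singleton).mem_nhds (hmem w hw)),
      hhℓ w (hmem w hw)⟩⟩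
  obtain rfl := hh.unique hloc
  obtain ⟨L, hL, haL, hn⟩ := ha
  have ha0 : ∀ t, a t ≠ 0 := fun t => haL t ▸ exp_ne_zero _
  have hac : Continuous a := by rw [funext haL]; fun_prop
  refine ⟨fun t => d * L t + ℓ (a t), (continuous_const.mul hL).add
    (hℓ.comp_continuous hac fun t => hmem _ (ha0 t)), fun t => ?_, fun t => ?_⟩
  · beta_reduce
    rw [hhℓ _ (hmem _ (ha0 t)), Complex.exp_add, exp_int_mul, ← haL]
  · have hp : a (t + 2 * Real.pi) = a t := by rw [haL, haL, hn, exp_add_two_pi_mul_int_mul_I]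
    simp only [hp, hn]; push_cast; ring

end HasLocalDegree

/-- The first homogeneous coordinate of a point of the sphere, `∞` being `[1 : 0]`. -/
noncomputable def num (z : Sphere2) : ℂ := z.elim 1 id

/-- The second homogeneous coordinate of a point of the sphere, finite points being `[a : 1]`. -/
noncomputable def den (z : Sphere2) : ℂ := z.elim 0 fun _ => 1

@[simp] theorem num_infty : num OnePoint.infty = 1 := rfl
@[simp] theorem den_infty : den OnePoint.infty = 0 := rfl
@[simp] theorem num_coe (a : ℂ) : num (a : Sphere2) = a := rfl
@[simp] theorem den_coe (a : ℂ) : den (a : Sphere2) = 1 := rfl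

/-- The determinant of the homogeneous coordinates of two points. -/
noncomputable def bracket (z u : Sphere2) : ℂ := num z * den u - den z * num u

theorem bracket_eq_zero_iff {z u : Sphere2} : bracket z u = 0 ↔ z = u := by
  induction z using OnePoint.rec <;> induction u using OnePoint.rec <;>
    simp [bracket, sub_eq_zero]

theorem bracket_ne_zero {z u : Sphere2} (h : z ≠ u) : bracket z u ≠ 0 :=
  mt bracket_eq_zero_iff.1 h

@[simp] theorem bracket_self (z : Sphere2) : bracket z z = 0 := bracket_eq_zero_iff.2 rfl

/-- The Möbius coordinate with its zero at `u` and its pole at `v`; at the pole its value is `0`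
by the convention for division. -/
noncomputable def mobius (u v z : Sphere2) : ℂ := bracket z u / bracket z v

@[simp] theorem mobius_self (u v : Sphere2) : mobius u v u = 0 := by
  simp [mobius]

theorem mobius_ne_zero {u v z : Sphere2} (hu : z ≠ u) (hv : z ≠ v) : mobius u v z ≠ 0 :=
  div_ne_zero (bracket_ne_zero hu) (bracket_ne_zero hv)

theorem mobius_mul {u v y z : Sphere2} (hv : z ≠ v) :
    mobius u v z * mobius v y z = mobius u y z :=
  div_mul_div_cancel₀ (bracket_ne_zero hv)

theorem inv_mobius (u v z : Sphere2) : (mobius u v z)⁻¹ = mobius v u z := by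
  simp [mobius]

theorem mobius_eq_mul {u v z e : Sphere2} (hu : e ≠ u) (hv : e ≠ v) (hz : z ≠ v) :
    mobius u v z = mobius u v e * (1 - mobius e v z * mobius v e u) := by
  have hev := bracket_ne_zero hv
  have hzv := bracket_ne_zero hz
  have hue := bracket_ne_zero hu.symm
  unfold mobius
  field_simp
  unfold bracket
  ring

theorem continuousAt_mobius {u v z : Sphere2} (h : z ≠ v) : ContinuousAt (mobius u v) z := by
  induction z using OnePoint.rec with
  | infty =>
    have hv : den v - 0 * num v ≠ 0 := by simpa [bracket] using bracket_ne_zero h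
    have hinv : Tendsto (fun z : ℂ => z⁻¹) (coclosedCompact ℂ) (𝓝 0) := by
      rw [coclosedCompact_eq_cocompact, ← Metric.cobounded_eq_cocompact]
      exact tendsto_inv₀_cobounded
    have hne : ∀ᶠ z : ℂ in coclosedCompact ℂ, z ≠ 0 := by
      rw [coclosedCompact_eq_cocompact, ← Metric.cobounded_eq_cocompact]
      exact Bornology.eventually_ne_cobounded 0
    have hlim : Tendsto (fun z : ℂ => (den u - z⁻¹ * num u) / (den v - z⁻¹ * num v))
        (coclosedCompact ℂ) (𝓝 (mobius u v OnePoint.infty)) := by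
      have hval : mobius u v OnePoint.infty = (den u - 0 * num u) / (den v - 0 * num v) := by
        simp [mobius, bracket]
      rw [hval]
      exact ((hinv.mul_const (num u)).const_sub (den u)).div
        ((hinv.mul_const (num v)).const_sub (den v)) hv
    refine OnePoint.continuousAt_infty'.2 (hlim.congr' (hne.mono fun z hz => ?_))
    rw [← mul_div_mul_left _ _ hz]
    simp [mobius, bracket, mul_sub, hz]
  | coe c =>
    have hv : c * den v - num v ≠ 0 := by simpa [bracket] using bracket_ne_zero h
    have hcont : ContinuousAt (fun z : ℂ => (z * den u - num u) / (z * den v - num v)) c :=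
      ContinuousAt.div (by fun_prop) (by fun_prop) hv
    refine OnePoint.continuousAt_coe.2 (hcont.congr (.of_forall fun z => ?_))
    simp [mobius, bracket]

/-- The point of the sphere with given homogeneous coordinates, not both zero. -/
noncomputable def ofHom (a b : ℂ) : Sphere2 :=
  open Classical in if b = 0 then OnePoint.infty else ((a / b : ℂ) : Sphere2)

theorem ofHom_of_ne_zero {a b : ℂ} (hb : b ≠ 0) : ofHom a b = ((a / b : ℂ) : Sphere2) := by
  simp [ofHom, hb]

theorem ofHom_mul_mul {c : ℂ} (hc : c ≠ 0) (a b : ℂ) : ofHom (c * a) (c * b) = ofHom a b := by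
  by_cases hb : b = 0 <;> simp [ofHom, hb, hc, mul_div_mul_left]

@[simp] theorem ofHom_num_den (z : Sphere2) : ofHom (num z) (den z) = z := by
  induction z using OnePoint.rec <;> simp [ofHom]

theorem exists_bracket_ofHom {a b : ℂ} (h : a ≠ 0 ∨ b ≠ 0) :
    ∃ c : ℂ, c ≠ 0 ∧ ∀ u, bracket (ofHom a b) u = c * (a * den u - b * num u) := by
  by_cases hb : b = 0
  · have ha : a ≠ 0 := by tauto
    exact ⟨a⁻¹, inv_ne_zero ha, fun u => by simp [ofHom, hb, bracket, ha]⟩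
  · refine ⟨b⁻¹, inv_ne_zero hb, fun u => ?_⟩
    simp only [ofHom, hb, if_false, bracket, num_coe, den_coe]
    field_simp

theorem continuousAt_ofHom_one_zero : ContinuousAt (ofHom 1) 0 := by
  have h0 : ofHom 1 0 = OnePoint.infty := by simp [ofHom]
  rw [continuousAt_iff_punctured_nhds, h0]
  have hinv : Tendsto (fun w : ℂ => w⁻¹) (𝓝[≠] 0) (coclosedCompact ℂ) := by
    rw [coclosedCompact_eq_cocompact, ← Metric.cobounded_eq_cocompact]
    exact tendsto_inv₀_nhdsNE_zero
  refine (OnePoint.tendsto_coe_infty.comp hinv).congr' ?_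
  filter_upwards [self_mem_nhdsWithin] with w hw
  simp [ofHom_of_ne_zero (show w ≠ 0 from hw)]

theorem continuousAt_ofHom {a b : ℂ} (h : a ≠ 0 ∨ b ≠ 0) :
    ContinuousAt (fun x : ℂ × ℂ => ofHom x.1 x.2) (a, b) := by
  by_cases hb : b = 0
  · have ha : a ≠ 0 := by tauto
    have hdiv : ContinuousAt (fun x : ℂ × ℂ => x.2 / x.1) (a, b) :=
      continuousAt_snd.div continuousAt_fst ha
    have hcont : ContinuousAt (fun x : ℂ × ℂ => ofHom 1 (x.2 / x.1)) (a, b) :=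
      ContinuousAt.comp_of_eq continuousAt_ofHom_one_zero hdiv (by simp [hb])
    refine hcont.congr ?_
    filter_upwards [continuousAt_fst.eventually_ne ha] with x hx
    rw [← ofHom_mul_mul hx, mul_one, mul_div_cancel₀ _ hx]
  · have hcont : ContinuousAt (fun x : ℂ × ℂ => ((x.1 / x.2 : ℂ) : Sphere2)) (a, b) :=
      OnePoint.continuous_coe.continuousAt.comp (continuousAt_fst.div continuousAt_snd hb)
    refine hcont.congr ?_
    filter_upwards [continuousAt_snd.eventually_ne hb] with x hx
    exact (ofHom_of_ne_zero hx).symm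

/-- The inverse of the Möbius coordinate `mobius u v`. -/
noncomputable def mobiusInv (u v : Sphere2) (ζ : ℂ) : Sphere2 :=
  ofHom (num u - ζ * num v) (den u - ζ * den v)

@[simp] theorem mobiusInv_zero (u v : Sphere2) : mobiusInv u v 0 = u := by
  simp [mobiusInv]

section MobiusInv

variable {u v : Sphere2}

theorem mobiusInv_coords_ne_zero (h : u ≠ v) (ζ : ℂ) :
    num u - ζ * num v ≠ 0 ∨ den u - ζ * den v ≠ 0 := by
  by_contra! hc
  apply bracket_ne_zero h
  unfold bracket
  linear_combination den v * hc.1 - num v * hc.2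

theorem exists_bracket_mobiusInv (h : u ≠ v) (ζ : ℂ) :
    ∃ c : ℂ, c ≠ 0 ∧ bracket (mobiusInv u v ζ) u = c * ζ * bracket u v ∧
      bracket (mobiusInv u v ζ) v = c * bracket u v := by
  obtain ⟨c, hc, hb⟩ := exists_bracket_ofHom (mobiusInv_coords_ne_zero h ζ)
  refine ⟨c, hc, ?_, ?_⟩ <;> unfold mobiusInv <;> rw [hb] <;> unfold bracket <;> ring

theorem mobiusInv_ne_right (h : u ≠ v) (ζ : ℂ) : mobiusInv u v ζ ≠ v := by
  obtain ⟨c, hc, -, hv⟩ := exists_bracket_mobiusInv h ζ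
  rw [← bracket_eq_zero_iff.ne, hv]
  exact mul_ne_zero hc (bracket_ne_zero h)

theorem mobius_mobiusInv (h : u ≠ v) (ζ : ℂ) : mobius u v (mobiusInv u v ζ) = ζ := by
  obtain ⟨c, hc, hu, hv⟩ := exists_bracket_mobiusInv h ζ
  have hbr := bracket_ne_zero h
  rw [mobius, hu, hv]
  field_simp

theorem mobiusInv_mobius {z : Sphere2} (h : u ≠ v) (hz : z ≠ v) :
    mobiusInv u v (mobius u v z) = z := by
  have huv := bracket_ne_zero h
  have hzv := bracket_ne_zero hz
  have hnum : num u - mobius u v z * num v = bracket u v / bracket z v * num z := by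
    unfold mobius; field_simp; unfold bracket; ring
  have hden : den u - mobius u v z * den v = bracket u v / bracket z v * den z := by
    unfold mobius; field_simp; unfold bracket; ring
  rw [mobiusInv, hnum, hden, ofHom_mul_mul (div_ne_zero huv hzv), ofHom_num_den]

theorem mobiusInv_ne_left (h : u ≠ v) {ζ : ℂ} (hζ : ζ ≠ 0) : mobiusInv u v ζ ≠ u := fun he => by
  have := mobius_mobiusInv h ζ
  rw [he, mobius_self] at this
  exact hζ this.symm

theorem mobiusInv_comm (h : u ≠ v) {ζ : ℂ} (hζ : ζ ≠ 0) :
    mobiusInv v u ζ = mobiusInv u v ζ⁻¹ := by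
  have hne := mobiusInv_ne_left h.symm hζ
  rw [← mobiusInv_mobius h hne, ← inv_mobius, mobius_mobiusInv h.symm]

theorem continuous_mobiusInv (h : u ≠ v) : Continuous (mobiusInv u v) :=
  continuous_iff_continuousAt.2 fun ζ =>
    (continuousAt_ofHom (mobiusInv_coords_ne_zero h ζ)).comp
      (f := fun ζ : ℂ => (num u - ζ * num v, den u - ζ * den v)) (by fun_prop)

end MobiusInv

/-- The winding number of the closed curve `γ` relative to the ordered pair of points `u`, `v`:
the winding number around `0` of its image under a Möbius map sending `u` to `0` and `v` to `∞`.
Its value is only meaningful when `γ` avoids `u` and `v`. -/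
noncomputable def index (γ : Circle → Sphere2) (u v : Sphere2) : ℤ :=
  open Classical in
  if h : ∃ n, HasWindingNumber (fun t => mobius u v (γ (Circle.exp t))) n then h.choose else 0

theorem index_eq {γ : Circle → Sphere2} {u v : Sphere2} {n : ℤ}
    (h : HasWindingNumber (fun t => mobius u v (γ (Circle.exp t))) n) : index γ u v = n := by
  have h' : ∃ n, HasWindingNumber (fun t => mobius u v (γ (Circle.exp t))) n := ⟨n, h⟩
  rw [index, dif_pos h']
  exact h'.choose_spec.unique h

theorem ne_of_notMem_range {X Y : Type*} {c : X → Y} {u : Y} (hu : u ∉ Set.range c) (x : X) :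
    c x ≠ u :=
  fun h => hu ⟨x, h⟩

theorem continuous_mobius_comp {X : Type*} [TopologicalSpace X] {c : X → Sphere2}
    (hc : Continuous c) (u : Sphere2) {v : Sphere2} (hv : v ∉ Set.range c) :
    Continuous fun x => mobius u v (c x) :=
  continuous_iff_continuousAt.2 fun x =>
    (continuousAt_mobius (ne_of_notMem_range hv x)).comp hc.continuousAt

section Index

variable {γ : Circle → Sphere2}

theorem isOpen_compl_range (hγ : Continuous γ) : IsOpen (Set.range γ)ᶜ :=
  (isCompact_range hγ).isClosed.isOpen_compl

theorem hasWindingNumber_index (hγ : Continuous γ) {u v : Sphere2} (hu : u ∉ Set.range γ)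
    (hv : v ∉ Set.range γ) :
    HasWindingNumber (fun t => mobius u v (γ (Circle.exp t))) (index γ u v) := by
  obtain ⟨n, hn⟩ := exists_hasWindingNumber
    ((continuous_mobius_comp hγ u hv).comp Circle.exp.continuous)
    (fun t => mobius_ne_zero (ne_of_notMem_range hu _) (ne_of_notMem_range hv _))
    (fun t => by simp [Circle.exp_add])
  rw [index_eq hn]
  exact hn

theorem index_add (hγ : Continuous γ) {u v y : Sphere2} (hu : u ∉ Set.range γ)
    (hv : v ∉ Set.range γ) (hy : y ∉ Set.range γ) :
    index γ u v + index γ v y = index γ u y := by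
  refine (index_eq ?_).symm
  have := (hasWindingNumber_index hγ hu hv).mul (hasWindingNumber_index hγ hv hy)
  simpa only [mobius_mul (ne_of_notMem_range hv _)] using this

theorem index_swap (hγ : Continuous γ) {u v : Sphere2} (hu : u ∉ Set.range γ)
    (hv : v ∉ Set.range γ) : index γ v u = -index γ u v := by
  have huu := index_add hγ hu hu hu
  have huvu := index_add hγ hu hv hu
  lia

theorem eventually_index_eq_zero (hγ : Continuous γ) {v : Sphere2} (hv : v ∉ Set.range γ) :
    ∀ᶠ u in 𝓝 v, index γ u v = 0 := by
  have hγv := ne_of_notMem_range hv 1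
  obtain ⟨C, hC⟩ := isCompact_univ.exists_bound_of_continuousOn
    (continuous_mobius_comp hγ (γ 1) hv).continuousOn
  have hsmall : Tendsto (fun u => C * ‖mobius v (γ 1) u‖) (𝓝 v) (𝓝 0) := by
    simpa using (continuousAt_mobius (u := v) hγv.symm).norm.tendsto.const_mul C
  filter_upwards [hsmall.eventually (gt_mem_nhds one_pos), (isOpen_compl_range hγ).mem_nhds hv]
    with u hu hu'
  have hγu := ne_of_notMem_range hu' 1
  have hnear : HasWindingNumber (fun t : ℝ =>
      1 - mobius (γ 1) v (γ (Circle.exp t)) * mobius v (γ 1) u) 0 := by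
    refine hasWindingNumber_zero_of_norm_sub_one_lt ?_ (fun t => by simp [Circle.exp_add])
      fun t => ?_
    · exact continuous_const.sub
        (((continuous_mobius_comp hγ _ hv).comp Circle.exp.continuous).mul continuous_const)
    · rw [sub_sub_cancel_left, norm_neg, norm_mul]
      exact (mul_le_mul_of_nonneg_right (hC _ trivial) (norm_nonneg _)).trans_lt hu
  apply index_eq
  have := (hasWindingNumber_const (mobius_ne_zero hγu hγv)).mul hnear
  simpa only [← mobius_eq_mul hγu hγv (ne_of_notMem_range hv _), add_zero] using this

theorem continuousOn_index (hγ : Continuous γ) {v : Sphere2} (hv : v ∉ Set.range γ) :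
    ContinuousOn (fun u => index γ u v) (Set.range γ)ᶜ := by
  refine fun u hu => ContinuousAt.continuousWithinAt ?_
  refine (continuousAt_const (y := index γ u v)).congr ?_
  filter_upwards [eventually_index_eq_zero hγ hu, (isOpen_compl_range hγ).mem_nhds hu] with w hw hw'
  rw [← index_add hγ hw' hu hv, hw, zero_add]

theorem index_eq_zero_of_isPreconnected (hγ : Continuous γ) {S : Set Sphere2}
    (hS : IsPreconnected S) (hSγ : S ⊆ (Set.range γ)ᶜ) {u v : Sphere2} (hu : u ∈ S) (hv : v ∈ S) :
    index γ u v = 0 := by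
  rw [hS.constant_of_mapsTo .univ ((continuousOn_index hγ (hSγ hv)).mono hSγ)
    (Set.mapsTo_univ _ _) hu hv]
  exact (eventually_index_eq_zero hγ (hSγ hv)).self_of_nhds

theorem exists_log_extension (hγ : Continuous γ) (hi : Function.Injective γ) {c : Circle → ℂ}
    (hc : HasWindingNumber (fun t => c (Circle.exp t)) 0) :
    ∃ ℓ : Sphere2 → ℂ, Continuous ℓ ∧ ∀ z, c z = exp (ℓ (γ z)) := by
  obtain ⟨L, hL, hcL, hp⟩ := hc
  have hper : Function.Periodic L (2 * Real.pi) := fun t => by simpa using hp t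
  have hq : Topology.IsQuotientMap Circle.exp :=
    Circle.isCoveringMap_exp.isQuotientMap Circle.exp_surjective
  have hlift : ∀ a b, Circle.exp a = Circle.exp b → L a = L b := fun a b hab => by
    obtain ⟨m, rfl⟩ := Circle.exp_eq_exp.1 hab
    exact hper.int_mul m b
  let ℓ : C(Circle, ℂ) := hq.lift (f := Circle.exp) ⟨L, hL⟩ hlift
  have hℓ : ∀ t, ℓ (Circle.exp t) = L t := fun t =>
    congrArg (fun g : C(ℝ, ℂ) => g t) (hq.lift_comp (f := Circle.exp) ⟨L, hL⟩ hlift)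
  obtain ⟨g, hg⟩ := ℓ.exists_extension' (hγ.isClosedEmbedding hi)
  refine ⟨g, g.continuous, fun z => ?_⟩
  obtain ⟨t, rfl⟩ := Circle.exp_surjective z
  exact (hcL t).trans (by rw [← hℓ, ← hg, Function.comp_apply])

theorem exists_continuousOn_eqOn_compl {X Y : Type*} [TopologicalSpace X] [TopologicalSpace Y]
    {A B s : Set X} (hA : IsOpen A) (hB : IsOpen B) (hAB : Disjoint A B) {f g : X → Y}
    (hf : ContinuousOn f (s \ B)) (hg : ContinuousOn g (s \ A)) (hfg : Set.EqOn f g (A ∪ B)ᶜ) :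
    ∃ h, ContinuousOn h s ∧ Set.EqOn h f Bᶜ ∧ Set.EqOn h g Aᶜ := by
  classical
  have hfB : Set.EqOn (A.piecewise f g) f Bᶜ := fun x hx => by
    by_cases hxA : x ∈ A
    · exact A.piecewise_eq_of_mem _ _ hxA
    · rw [A.piecewise_eq_of_notMem _ _ hxA, hfg (by simp_all)]
  have hgA : Set.EqOn (A.piecewise f g) g Aᶜ := fun x hx => A.piecewise_eq_of_notMem _ _ hx
  have hcont : ∀ {C : Set X}, IsOpen C → ContinuousOn (A.piecewise f g) (s \ C) → ∀ x ∈ s,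
      ContinuousWithinAt (A.piecewise f g) (s \ C) x := fun {C} hC hp x hx => by
    by_cases hxC : x ∈ C
    · refine continuousWithinAt_of_notMem_closure fun h => ?_
      exact closure_minimal (fun y hy => hy.2) hC.isClosed_compl h hxC
    · exact hp x ⟨hx, hxC⟩
  refine ⟨A.piecewise f g, fun x hx => ?_, hfB, hgA⟩
  have hs : s = s \ B ∪ s \ A := by
    rw [← Set.sdiff_inter, hAB.symm.inter_eq, Set.sdiff_empty]
  rw [hs]
  exact (hcont hB (hf.congr fun y hy => hfB hy.2) x hx).union
    (hcont hA (hg.congr fun y hy => hgA hy.2) x hx)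

theorem exists_extension_mobius_zpow (hγ : Continuous γ) (hi : Function.Injective γ)
    {A B : Set Sphere2} (hA : IsOpen A) (hB : IsOpen B) (hAB : Disjoint A B)
    (hU : A ∪ B = (Set.range γ)ᶜ) {u v y : Sphere2} (hu : u ∈ A) (hv : v ∈ B) (hy : y ∈ B) :
    ∃ G : Sphere2 → ℂ, ContinuousOn G {y}ᶜ ∧ (∀ z ≠ y, G z ≠ 0) ∧
      ∀ z ∈ B, G z = mobius u y z ^ index γ v y := by
  have hmem : ∀ {z}, z ∈ A ∨ z ∈ B ↔ z ∉ Set.range γ := fun {z} => Set.ext_iff.1 hU z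
  have huγ := hmem.1 (Or.inl hu)
  have hvγ := hmem.1 (Or.inr hv)
  have hyγ := hmem.1 (Or.inr hy)
  set k := index γ v y
  set l := index γ u y
  have hwinding := ((hasWindingNumber_index hγ huγ hyγ).zpow k).mul
    ((hasWindingNumber_index hγ hvγ hyγ).zpow (-l))
  rw [show k * l + -l * k = 0 by ring] at hwinding
  obtain ⟨ℓ, hℓ, hℓγ⟩ := exists_log_extension hγ hi
    (c := fun z => mobius u y (γ z) ^ k * mobius v y (γ z) ^ (-l)) hwinding
  set GA : Sphere2 → ℂ := fun z => exp (ℓ z) * mobius v y z ^ l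
  set GB : Sphere2 → ℂ := fun z => mobius u y z ^ k
  have hγ_eq : Set.EqOn GA GB (A ∪ B)ᶜ := fun z hz => by
    rw [hU, compl_compl] at hz
    obtain ⟨c, rfl⟩ := hz
    have hne := mobius_ne_zero (ne_of_notMem_range hvγ c) (ne_of_notMem_range hyγ c)
    simp only [GA, GB, ← hℓγ, mul_assoc, ← zpow_add₀ hne, neg_add_cancel, zpow_zero, mul_one]
  have hGA : ∀ z ≠ y, z ∉ B → ContinuousAt GA z ∧ GA z ≠ 0 := fun z hzy hz => by
    have hne : mobius v y z ≠ 0 := mobius_ne_zero (fun h => hz (h ▸ hv)) hzy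
    exact ⟨hℓ.continuousAt.cexp.mul ((continuousAt_mobius hzy).zpow₀ _ (Or.inl hne)),
      mul_ne_zero (exp_ne_zero _) (zpow_ne_zero _ hne)⟩
  have hGB : ∀ z ≠ y, z ∉ A → ContinuousAt GB z ∧ GB z ≠ 0 := fun z hzy hz => by
    have hne : mobius u y z ≠ 0 := mobius_ne_zero (fun h => hz (h ▸ hu)) hzy
    exact ⟨(continuousAt_mobius hzy).zpow₀ _ (Or.inl hne), zpow_ne_zero _ hne⟩
  obtain ⟨G, hG, hGA', hGB'⟩ := exists_continuousOn_eqOn_compl (s := {y}ᶜ) hA hB hAB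
    (fun z hz => (hGA z hz.1 hz.2).1.continuousWithinAt)
    (fun z hz => (hGB z hz.1 hz.2).1.continuousWithinAt) hγ_eq
  refine ⟨G, hG, fun z hzy => ?_, fun z hz => hGB' fun hzA => Set.disjoint_left.1 hAB hzA hz⟩
  by_cases hz : z ∈ B
  · have hzA : z ∉ A := fun hzA => Set.disjoint_left.1 hAB hzA hz
    exact (hGB' hzA).symm ▸ (hGB z hzy hzA).2
  · exact (hGA' hz).symm ▸ (hGA z hzy hz).2

/-- If `B` is one of two disjoint open pieces of the complement of a Jordan curve, then the index
cannot distinguish points of `B`: a power of a Möbius coordinate would otherwise extend across the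
other piece without zeros. -/
theorem index_eq_zero_of_isOpen (hγ : Continuous γ) (hi : Function.Injective γ)
    {A B : Set Sphere2} (hA : IsOpen A) (hB : IsOpen B) (hAB : Disjoint A B)
    (hU : A ∪ B = (Set.range γ)ᶜ) {u v y : Sphere2} (hu : u ∈ A) (hv : v ∈ B) (hy : y ∈ B) :
    index γ v y = 0 := by
  obtain ⟨G, hG, hG0, hGB⟩ := exists_extension_mobius_zpow hγ hi hA hB hAB hU hu hv hy
  set k := index γ v y
  have huy : u ≠ y := fun h => Set.disjoint_left.1 hAB hu (h ▸ hy)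
  have hnhds : mobiusInv y u ⁻¹' B ∈ 𝓝 0 :=
    (continuous_mobiusInv huy.symm).continuousAt (by simpa using hB.mem_nhds hy)
  obtain ⟨r, hr, hrB⟩ := Metric.nhds_basis_closedBall.mem_iff.1 hnhds
  have hr0 : (r : ℂ)⁻¹ ≠ 0 := inv_ne_zero (ofReal_ne_zero.2 hr.ne')
  set a : ℝ → ℂ := fun t => (r : ℂ)⁻¹ * exp (t * I)
  have haG : ∀ t, G (mobiusInv u y (a t)) = a t ^ k := fun t => by
    have hB : mobiusInv u y (a t) ∈ B := by
      rw [mobiusInv_comm huy.symm (mul_ne_zero hr0 (exp_ne_zero _))]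
      refine hrB ?_
      simp [← Complex.exp_neg, norm_exp, abs_of_pos hr]
    rw [hGB _ hB, mobius_mobiusInv huy]
  have hpow : HasWindingNumber (fun t => a t ^ k) (k * (0 + 1)) :=
    ((hasWindingNumber_const hr0).mul hasWindingNumber_exp).zpow k
  have hzero : HasWindingNumber (fun t => G (mobiusInv u y (a t))) 0 := by
    refine hasWindingNumber_comp_of_ne_zero
      (hG.comp_continuous (continuous_mobiusInv huy) (mobiusInv_ne_right huy))
      (fun ζ => hG0 _ (mobiusInv_ne_right huy ζ)) (by fun_prop) fun t => ?_
    simp [a, add_mul, Complex.exp_add]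
  simp only [haG] at hzero
  simpa using hpow.unique hzero

end Index

/-- The cross-ratio of four points of the sphere: the ratio of the values at `z` and at `y` of a
Möbius coordinate with zero `a` and pole `t`. Written without dividing, it varies continuously with
`a` and equals `1` at `a = t`. -/
noncomputable def crossRatio (t y z a : Sphere2) : ℂ := 1 - mobius t y a * mobius y t z

@[simp] theorem crossRatio_self (t y z : Sphere2) : crossRatio t y z t = 1 := by
  simp [crossRatio]

theorem mobius_eq_mul_crossRatio {t y z a : Sphere2} (hya : y ≠ a) (hyt : y ≠ t) (hz : z ≠ t) :
    mobius a t z = mobius a t y * crossRatio t y z a := by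
  rw [mobius_eq_mul hya hyt hz, crossRatio, mul_comm (mobius y t z)]

theorem mobius_eq_mul_crossRatio_right {t y z a : Sphere2} (hz : t ≠ z) (hty : t ≠ y)
    (ha : a ≠ y) : mobius z y a = mobius z y t * crossRatio t y z a :=
  mobius_eq_mul hz hty ha

theorem crossRatio_ne_zero {t y z a : Sphere2} (hya : y ≠ a) (hyt : y ≠ t) (hz : z ≠ t)
    (hza : z ≠ a) : crossRatio t y z a ≠ 0 := by
  have := mobius_ne_zero hza hz
  rw [mobius_eq_mul_crossRatio hya hyt hz] at this
  exact right_ne_zero_of_mul this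

theorem range_circleExp_pi_mul :
    Set.range (fun τ : unitInterval => Circle.exp (Real.pi * τ)) =
      {z : Circle | 0 ≤ (z : ℂ).im} := by
  ext z
  have hpi := Real.pi_pos
  constructor
  · rintro ⟨τ, rfl⟩
    simp only [Set.mem_ofPred_eq, Circle.coe_exp, exp_ofReal_mul_I_im]
    exact Real.sin_nonneg_of_nonneg_of_le_pi (by have := τ.2.1; positivity)
      (mul_le_of_le_one_right hpi.le τ.2.2)
  · intro hz
    refine ⟨⟨arg z / Real.pi, div_nonneg (arg_nonneg_iff.2 hz) hpi.le,
      (div_le_one hpi).2 (arg_le_pi _)⟩, ?_⟩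
    simp only [mul_div_cancel₀ _ hpi.ne', Circle.exp_arg]

theorem range_circleExp_neg_pi_mul :
    Set.range (fun τ : unitInterval => Circle.exp (-Real.pi * τ)) =
      {z : Circle | (z : ℂ).im ≤ 0} := by
  have hinv : (fun τ : unitInterval => Circle.exp (-Real.pi * τ)) =
      Inv.inv ∘ fun τ : unitInterval => Circle.exp (Real.pi * τ) := by
    ext1 τ
    simp [Circle.exp_neg]
  rw [hinv, Set.range_comp, range_circleExp_pi_mul, Set.image_inv_eq_inv]
  ext z
  simp

theorem exists_log_crossRatio {c : unitInterval → Sphere2} (hc : Continuous c) {y : Sphere2}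
    (hy : y ∉ Set.range c) :
    ∃ ℓ : Sphere2 → ℂ, ContinuousOn ℓ (Set.range c)ᶜ ∧
      (∀ z ∉ Set.range c, crossRatio (c 0) y z (c 1) = exp (ℓ z)) ∧
      ∀ z ∉ Set.range c, ∀ L : unitInterval → ℂ, Continuous L →
        (∀ τ, crossRatio (c 0) y z (c τ) = exp (L τ)) → ℓ z = L 1 - L 0 := by
  classical
  set S := (Set.range c)ᶜ
  let F : unitInterval × S → ℂ := fun x => crossRatio (c 0) y x.2 (c x.1)
  have hF : Continuous F := by
    refine continuous_const.sub
      (((continuous_mobius_comp hc (c 0) hy).comp continuous_fst).mul ?_)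
    exact (continuous_mobius_comp (continuous_subtype_val (p := (· ∈ S))) y (v := c 0)
      fun ⟨z, hz⟩ => z.2 (hz ▸ Set.mem_range_self 0)).comp continuous_snd
  obtain ⟨M, hM, hFM, hM0⟩ := exists_log_homotopy hF
    (fun x => crossRatio_ne_zero (ne_of_notMem_range hy _).symm (ne_of_notMem_range hy _).symm
      (ne_of_notMem_range x.2.2 _).symm (ne_of_notMem_range x.2.2 _).symm)
    (fun x => crossRatio_self _ _ _)
  refine ⟨fun z => if hz : z ∈ S then M (1, ⟨z, hz⟩) else 0, ?_, fun z hz => ?_,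
    fun z hz L hL hexp => ?_⟩
  · rw [continuousOn_iff_continuous_domRestrict]
    have : Continuous fun x : S => M (1, x) := by fun_prop
    convert this using 2 with x
    exact dif_pos x.2
  · exact (hFM (1, ⟨z, hz⟩)).trans (by simp only [dif_pos (Set.mem_compl hz), S])
  · obtain ⟨n, hn⟩ := exists_int_of_exp_eq_of_continuous (A := fun τ => M (τ, ⟨z, hz⟩)) (B := L)
      (by fun_prop) hL (fun τ => by rw [← hFM, ← hexp])
    have hn0 := hn 0
    simp only [hM0] at hn0
    simp only [dif_pos (show z ∈ S from hz), hn 1]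
    linear_combination -hn0

theorem circle_eq_one_or_neg_one {z : Circle} (hz : (z : ℂ).im = 0) : z = 1 ∨ z = -1 := by
  have hsq : (z : ℂ) ^ 2 = 1 := by
    rw [sq]
    nth_rw 2 [← conj_eq_iff_im.2 hz]
    rw [mul_conj, Circle.normSq_coe, ofReal_one]
  simpa [Circle.ext_iff] using hsq

theorem exists_continuousOn_compl_inter {X Y : Type*} [TopologicalSpace X] [TopologicalSpace Y]
    {A B : Set X} (hA : IsClosed A) (hB : IsClosed B) {f g : X → Y} (hf : ContinuousOn f Aᶜ)
    (hg : ContinuousOn g Bᶜ) (hfg : Set.EqOn f g (A ∪ B)ᶜ) :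
    ∃ h, ContinuousOn h (A ∩ B)ᶜ ∧ Set.EqOn h f Aᶜ ∧ Set.EqOn h g Bᶜ := by
  classical
  have hhf : Set.EqOn (A.piecewise g f) f Aᶜ := A.piecewise_eqOn_compl g f
  have hhg : Set.EqOn (A.piecewise g f) g Bᶜ := fun x hx => by
    by_cases hxA : x ∈ A
    · exact A.piecewise_eq_of_mem _ _ hxA
    · rw [hhf hxA, hfg (by simp_all)]
  refine ⟨A.piecewise g f, ?_, hhf, hhg⟩
  rw [Set.compl_inter]
  exact (hf.congr hhf).union_of_isOpen (hg.congr hhg) hA.isOpen_compl hB.isOpen_compl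

section JordanCurve

variable {γ : Circle → Sphere2}

theorem hasWindingNumber_crossRatio (hγ : Continuous γ) {y z : Sphere2} (hy : y ∉ Set.range γ)
    (hz : z ∉ Set.range γ) (a : Circle) :
    HasWindingNumber (fun t => crossRatio (γ a) y z (γ (Circle.exp t))) (index γ z y) := by
  have hne := mobius_ne_zero (ne_of_notMem_range hz a) (ne_of_notMem_range hy a)
  have hmul := (hasWindingNumber_const (inv_ne_zero hne)).mul (hasWindingNumber_index hγ hz hy)
  rw [zero_add] at hmul
  convert hmul using 2 with t
  rw [mobius_eq_mul_crossRatio_right (a := γ (Circle.exp t)) (ne_of_notMem_range hz a)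
    (ne_of_notMem_range hy a) (ne_of_notMem_range hy _), inv_mul_cancel_left₀ hne]


/-- The part of the closed curve `γ` of signed angle `σ` that starts at `γ 1`. -/
noncomputable def arc (γ : Circle → Sphere2) (σ : ℝ) (τ : unitInterval) : Sphere2 :=
  γ (Circle.exp (σ * τ))

@[simp] theorem arc_zero (σ : ℝ) : arc γ σ 0 = γ 1 := by simp [arc]

@[simp] theorem arc_pi_one : arc γ Real.pi 1 = γ (-1) := by
  have hπ : Circle.exp Real.pi = -1 := by ext; simp
  simp [arc, hπ]

@[simp] theorem arc_neg_pi_one : arc γ (-Real.pi) 1 = γ (-1) := by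
  have hπ : Circle.exp Real.pi = -1 := by ext; simp
  simp [arc, Circle.exp_neg, hπ]

theorem continuous_arc (hγ : Continuous γ) (σ : ℝ) : Continuous (arc γ σ) := by
  unfold arc; fun_prop

theorem range_arc_subset (σ : ℝ) : Set.range (arc γ σ) ⊆ Set.range γ :=
  Set.range_comp_subset_range _ γ

theorem range_arc_pi : Set.range (arc γ Real.pi) = γ '' {z : Circle | 0 ≤ (z : ℂ).im} := by
  rw [← range_circleExp_pi_mul, ← Set.range_comp]; rfl

theorem range_arc_neg_pi : Set.range (arc γ (-Real.pi)) = γ '' {z : Circle | (z : ℂ).im ≤ 0} := by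
  rw [← range_circleExp_neg_pi_mul, ← Set.range_comp]; rfl

theorem range_subset_range_arc_union :
    Set.range γ ⊆ Set.range (arc γ Real.pi) ∪ Set.range (arc γ (-Real.pi)) := by
  rw [range_arc_pi, range_arc_neg_pi, ← Set.image_union, ← Set.image_univ]
  exact Set.image_mono fun z _ => le_total 0 (z : ℂ).im

theorem range_arc_inter_subset (hi : Function.Injective γ) :
    Set.range (arc γ Real.pi) ∩ Set.range (arc γ (-Real.pi)) ⊆ {γ 1, γ (-1)} := by
  rw [range_arc_pi, range_arc_neg_pi, ← Set.image_inter hi, ← Set.image_pair]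
  exact Set.image_mono fun z hz => circle_eq_one_or_neg_one (le_antisymm hz.2 hz.1)

theorem exists_logs_crossRatio (hγ : Continuous γ) {y : Sphere2} (hy : y ∉ Set.range γ) :
    ∃ ℓ ℓ' : Sphere2 → ℂ, ContinuousOn ℓ (Set.range (arc γ Real.pi))ᶜ ∧
      ContinuousOn ℓ' (Set.range (arc γ (-Real.pi)))ᶜ ∧
      (∀ z ∉ Set.range (arc γ Real.pi), crossRatio (γ 1) y z (γ (-1)) = exp (ℓ z)) ∧
      (∀ z ∉ Set.range (arc γ (-Real.pi)), crossRatio (γ 1) y z (γ (-1)) = exp (ℓ' z)) ∧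
      ∀ z ∉ Set.range γ, ℓ z = ℓ' z + 2 * Real.pi * index γ z y * I := by
  obtain ⟨ℓ, hℓ, hexp, hℓL⟩ := exists_log_crossRatio (continuous_arc hγ Real.pi)
    fun h => hy (range_arc_subset _ h)
  obtain ⟨ℓ', hℓ', hexp', hℓL'⟩ := exists_log_crossRatio (continuous_arc hγ (-Real.pi))
    fun h => hy (range_arc_subset _ h)
  simp only [arc_zero, arc_pi_one, arc_neg_pi_one] at hexp hexp' hℓL hℓL'
  refine ⟨ℓ, ℓ', hℓ, hℓ', hexp, hexp', fun z hz => ?_⟩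
  obtain ⟨L, hL, hLexp, hinc⟩ := hasWindingNumber_crossRatio hγ hy hz 1
  have hincr := hℓL z (fun h => hz (range_arc_subset _ h)) (fun τ => L (Real.pi * τ)) (by fun_prop)
    fun τ => hLexp _
  have hincr' := hℓL' z (fun h => hz (range_arc_subset _ h)) (fun τ => L (-Real.pi * τ))
    (by fun_prop) fun τ => hLexp _
  have hperiod := hinc (-Real.pi)
  rw [show -Real.pi + 2 * Real.pi = Real.pi by ring] at hperiod
  simp only [Set.Icc.coe_zero, Set.Icc.coe_one, mul_zero, mul_one] at hincr hincr'
  rw [hincr, hincr', hperiod]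
  ring

/-- The logarithms of the cross-ratio on the complements of the two arcs joining `γ 1` to `γ (-1)`
differ by `2πi` times an index, so if `n` divides all indices then their `n`-th parts have
exponentials that fit together. -/
theorem exists_pow_eq_crossRatio (hγ : Continuous γ) (hi : Function.Injective γ) {y : Sphere2}
    (hy : y ∉ Set.range γ) {n : ℕ} (hn : n ≠ 0) (hdvd : ∀ z ∉ Set.range γ, (n : ℤ) ∣ index γ z y) :
    ∃ ρ : Sphere2 → ℂ, ContinuousOn ρ {γ 1, γ (-1)}ᶜ ∧
      ∀ z ∈ ({γ 1, γ (-1)}ᶜ : Set Sphere2), ρ z ^ n = crossRatio (γ 1) y z (γ (-1)) := by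
  obtain ⟨ℓ, ℓ', hℓ, hℓ', hexp, hexp', hdiff⟩ := exists_logs_crossRatio hγ hy
  have hclosed : ∀ σ, IsClosed (Set.range (arc γ σ)) := fun σ =>
    (isCompact_range (continuous_arc hγ σ)).isClosed
  have hn0 : (n : ℂ) ≠ 0 := Nat.cast_ne_zero.2 hn
  have hagree : Set.EqOn (fun z => exp (ℓ z / n)) (fun z => exp (ℓ' z / n))
      (Set.range (arc γ Real.pi) ∪ Set.range (arc γ (-Real.pi)))ᶜ := fun z hz => by
    have hzγ : z ∉ Set.range γ := fun h => hz (range_subset_range_arc_union h)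
    obtain ⟨k, hk⟩ := hdvd z hzγ
    refine exp_eq_exp_iff_exists_int.2 ⟨k, ?_⟩
    rw [hdiff z hzγ, hk]
    push_cast
    field_simp
  obtain ⟨ρ, hρ, hρℓ, hρℓ'⟩ := exists_continuousOn_compl_inter (hclosed _) (hclosed _)
    (hℓ.div_const _).cexp (hℓ'.div_const _).cexp hagree
  have hroot : ∀ w : ℂ, exp (w / n) ^ n = exp w := fun w => by
    rw [← exp_nat_mul, mul_div_cancel₀ _ hn0]
  refine ⟨ρ, hρ.mono (Set.compl_subset_compl.2 (range_arc_inter_subset hi)), fun z hz => ?_⟩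
  rcases not_and_or.1 fun h => hz (range_arc_inter_subset hi h) with h | h
  · rw [hρℓ h, hroot, hexp z h]
  · rw [hρℓ' h, hroot, hexp' z h]

theorem eq_one_of_pow_eq_mul_mobius {s t : Sphere2} (hst : s ≠ t) {ρ : Sphere2 → ℂ}
    (hρ : ContinuousOn ρ {t, s}ᶜ) {n : ℕ} (hn : n ≠ 0) {c : ℂ} (hc : c ≠ 0)
    (hpow : ∀ z ∈ ({t, s}ᶜ : Set Sphere2), ρ z ^ n = c * mobius s t z) : n = 1 := by
  set a : ℝ → Sphere2 := fun x => mobiusInv s t (exp (x * I))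
  have ha : ∀ x, a x ∈ ({t, s}ᶜ : Set Sphere2) := fun x hx =>
    hx.elim (mobiusInv_ne_right hst _) (mobiusInv_ne_left hst (exp_ne_zero _))
  have hpow' : ∀ x, ρ (a x) ^ n = c * exp (x * I) := fun x => by
    rw [hpow _ (ha x), mobius_mobiusInv hst]
  have hρa : ∀ x, ρ (a x) ≠ 0 := fun x => by
    rw [← pow_ne_zero_iff hn, hpow']
    exact mul_ne_zero hc (exp_ne_zero _)
  obtain ⟨j, hj⟩ := exists_hasWindingNumber (γ := fun x => ρ (a x))
    (hρ.comp_continuous ((continuous_mobiusInv hst).comp (by fun_prop)) ha)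
    hρa fun x => by simp [a, add_mul, Complex.exp_add]
  have hwinding : (n : ℤ) * j = 0 + 1 := (hj.zpow n).unique <| by
    simpa only [zpow_natCast, hpow'] using (hasWindingNumber_const hc).mul hasWindingNumber_exp
  exact_mod_cast Int.eq_one_of_dvd_one n.cast_nonneg ⟨j, by lia⟩

theorem not_forall_dvd_index (hγ : Continuous γ) (hi : Function.Injective γ) {y : Sphere2}
    (hy : y ∉ Set.range γ) {n : ℕ} (hn : n ≠ 1) : ¬ ∀ z ∉ Set.range γ, (n : ℤ) ∣ index γ z y := by
  have hne : ∀ a, y ≠ γ a := fun a => (ne_of_notMem_range hy a).symm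
  have hst : γ (-1) ≠ γ 1 := fun h => Circle.neg_ne_self 1 (hi h)
  suffices hpos : ∀ n : ℕ, n ≠ 0 → (∀ z ∉ Set.range γ, (n : ℤ) ∣ index γ z y) → n = 1 by
    intro hdvd
    rcases eq_or_ne n 0 with rfl | hn0
    · have hzero : ∀ z ∉ Set.range γ, ((2 : ℕ) : ℤ) ∣ index γ z y := fun z hz => by
        simp [Int.zero_dvd.1 (hdvd z hz)]
      exact absurd (hpos 2 two_ne_zero hzero) (by simp)
    · exact hn (hpos n hn0 hdvd)
  intro n hn hdvd
  obtain ⟨ρ, hρ, hpow⟩ := exists_pow_eq_crossRatio hγ hi hy hn hdvd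
  have hmobius := mobius_ne_zero (hne (-1)) (hne 1)
  refine eq_one_of_pow_eq_mul_mobius hst hρ hn (inv_ne_zero hmobius) fun z hz => ?_
  rw [hpow z hz, mobius_eq_mul_crossRatio (hne _) (hne _) fun h => hz (Or.inl h),
    inv_mul_cancel_left₀ hmobius]

theorem isPreconnected_compl_of_finite {P : Set Sphere2} (hP : P.Finite) : IsPreconnected Pᶜ := by
  have hplane : IsPreconnected (((↑) : ℂ → Sphere2) ⁻¹' P)ᶜ := by
    refine (Set.Countable.isConnected_compl_of_one_lt_rank ?_ ?_).isPreconnected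
    · rw [rank_real_complex]; norm_num
    · exact (hP.preimage OnePoint.coe_injective.injOn).countable
  refine (hplane.image ((↑) : ℂ → Sphere2) OnePoint.continuous_coe.continuousOn).subset_closure
    ?_ fun z _ => ?_
  · rintro _ ⟨z, hz, rfl⟩
    exact hz
  · have hdense : Dense (Set.univ \ insert OnePoint.infty P : Set Sphere2) :=
      dense_univ.sdiff_finite (hP.insert _)
    refine closure_mono ?_ (hdense z)
    rintro w ⟨-, hw⟩
    rw [Set.mem_insert_iff, not_or] at hw
    obtain ⟨c, rfl⟩ := OnePoint.ne_infty_iff_exists.1 hw.1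
    exact ⟨c, hw.2, rfl⟩

theorem exists_notMem_range (hγ : Continuous γ) (hi : Function.Injective γ) :
    ∃ y, y ∉ Set.range γ := by
  by_contra! hsurj
  have hne : (1 : Circle) ≠ -1 := (Circle.neg_ne_self 1).symm
  apply Circle.not_isPreconnected_compl_pair hne
  rw [← (hγ.isClosedEmbedding hi).isInducing.isPreconnected_image,
    Set.image_compl_eq ⟨hi, hsurj⟩]
  exact isPreconnected_compl_of_finite ((Set.toFinite _).image γ)

variable {U V : Set Sphere2}

theorem index_eq_one_or_neg_one_of_isOpen (hγ : Continuous γ) (hi : Function.Injective γ)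
    (hU : IsOpen U) (hV : IsOpen V) (hUV : Disjoint U V) (hunion : U ∪ V = (Set.range γ)ᶜ)
    {u v : Sphere2} (hu : u ∈ U) (hv : v ∈ V) : index γ u v = 1 ∨ index γ u v = -1 := by
  have hmem : ∀ {z}, z ∈ U ∨ z ∈ V ↔ z ∉ Set.range γ := fun {z} => Set.ext_iff.1 hunion z
  have huγ := hmem.1 (Or.inl hu)
  have hvγ := hmem.1 (Or.inr hv)
  rw [← Int.natAbs_eq_natAbs_iff, Int.natAbs_one]
  by_contra hone
  refine not_forall_dvd_index hγ hi hvγ hone fun z hz => Int.natAbs_dvd.2 ?_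
  rcases hmem.2 hz with hzU | hzV
  · rw [← index_add hγ hz huγ hvγ,
      index_eq_zero_of_isOpen hγ hi hV hU hUV.symm (Set.union_comm U V ▸ hunion) hv hzU hu,
      zero_add]
  · exact index_eq_zero_of_isOpen hγ hi hU hV hUV hunion hu hzV hv ▸ dvd_zero _

theorem isConnected_of_isOpen (hγ : Continuous γ) (hi : Function.Injective γ)
    (hU : IsOpen U) (hV : IsOpen V) (hUV : Disjoint U V) (hunion : U ∪ V = (Set.range γ)ᶜ)
    (hneU : U.Nonempty) (hneV : V.Nonempty) : IsConnected U := by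
  refine ⟨hneU, ?_⟩
  rintro A B hA hB hsub ⟨a, haU, haA⟩ ⟨b, hbU, hbB⟩
  by_contra hempty
  rw [Set.not_nonempty_iff_eq_empty, Set.eq_empty_iff_forall_notMem] at hempty
  obtain ⟨v, hv⟩ := hneV
  have hdisjoint : Disjoint (U ∩ A) (U ∩ B ∪ V) := by
    rw [Set.disjoint_left]
    rintro z ⟨hzU, hzA⟩ (⟨-, hzB⟩ | hzV)
    exacts [hempty z ⟨hzU, hzA, hzB⟩, Set.disjoint_left.1 hUV hzU hzV]
  have hcover : U ∩ A ∪ (U ∩ B ∪ V) = (Set.range γ)ᶜ := by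
    rw [← Set.union_assoc, ← Set.inter_union_distrib_left, Set.inter_eq_left.2 hsub, hunion]
  have hzero := index_eq_zero_of_isOpen hγ hi (hU.inter hA) ((hU.inter hB).union hV) hdisjoint
    hcover ⟨haU, haA⟩ (Or.inl ⟨hbU, hbB⟩) (Or.inr hv)
  have hone := index_eq_one_or_neg_one_of_isOpen hγ hi hU hV hUV hunion hbU hv
  lia

end JordanCurve

/-- `U` and `V` are the two sides of the Jordan curve `γ`: the two components of its complement,
which the curve separates with index `1` or `-1`. -/
structure AreSides (γ : Circle → Sphere2) (U V : Set Sphere2) : Prop where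
  isOpen_left : IsOpen U
  isOpen_right : IsOpen V
  disjoint : Disjoint U V
  union_eq : U ∪ V = (Set.range γ)ᶜ
  isConnected_left : IsConnected U
  isConnected_right : IsConnected V
  index_eq : ∀ u ∈ U, ∀ v ∈ V, index γ u v = 1 ∨ index γ u v = -1

theorem exists_areSides {γ : Circle → Sphere2} (hγ : Continuous γ) (hi : Function.Injective γ) :
    ∃ U V, AreSides γ U V := by
  obtain ⟨y, hy⟩ := exists_notMem_range hγ hi
  obtain ⟨z, hz, hz0⟩ : ∃ z, z ∉ Set.range γ ∧ index γ z y ≠ 0 := by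
    by_contra! hzero
    exact not_forall_dvd_index hγ hi hy (n := 2) (by simp) fun z hz => hzero z hz ▸ dvd_zero _
  set U := (Set.range γ)ᶜ ∩ (fun u => index γ u y) ⁻¹' {0}ᶜ
  set V := (Set.range γ)ᶜ ∩ (fun u => index γ u y) ⁻¹' {0}
  have hopen : ∀ s : Set ℤ, IsOpen ((Set.range γ)ᶜ ∩ (fun u => index γ u y) ⁻¹' s) := fun s =>
    (continuousOn_index hγ hy).isOpen_inter_preimage (isOpen_compl_range hγ) (isOpen_discrete s)
  have hUV : Disjoint U V := Set.disjoint_left.2 fun u hu hv => hu.2 hv.2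
  have hunion : U ∪ V = (Set.range γ)ᶜ := by
    rw [← Set.inter_union_distrib_left, ← Set.preimage_union, Set.compl_union_self,
      Set.preimage_univ, Set.inter_univ]
  have hneU : U.Nonempty := ⟨z, hz, hz0⟩
  have hneV : V.Nonempty := ⟨y, hy, (eventually_index_eq_zero hγ hy).self_of_nhds⟩
  exact ⟨U, V, hopen _, hopen _, hUV, hunion,
    isConnected_of_isOpen hγ hi (hopen _) (hopen _) hUV hunion hneU hneV,
    isConnected_of_isOpen hγ hi (hopen _) (hopen _) hUV.symm (Set.union_comm U V ▸ hunion) hneV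
      hneU,
    fun u hu v hv => index_eq_one_or_neg_one_of_isOpen hγ hi (hopen _) (hopen _) hUV hunion hu hv⟩

namespace AreSides

variable {γ : Circle → Sphere2} {U V : Set Sphere2}

theorem mem_or_mem_iff (h : AreSides γ U V) {z : Sphere2} : z ∈ U ∨ z ∈ V ↔ z ∉ Set.range γ :=
  Set.ext_iff.1 h.union_eq z

theorem left_notMem (h : AreSides γ U V) {u : Sphere2} (hu : u ∈ U) : u ∉ Set.range γ :=
  h.mem_or_mem_iff.1 (Or.inl hu)

theorem right_notMem (h : AreSides γ U V) {v : Sphere2} (hv : v ∈ V) : v ∉ Set.range γ :=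
  h.mem_or_mem_iff.1 (Or.inr hv)

theorem symm (hγ : Continuous γ) (h : AreSides γ U V) : AreSides γ V U where
  isOpen_left := h.isOpen_right
  isOpen_right := h.isOpen_left
  disjoint := h.disjoint.symm
  union_eq := by rw [Set.union_comm, h.union_eq]
  isConnected_left := h.isConnected_right
  isConnected_right := h.isConnected_left
  index_eq v hv u hu := by
    rw [index_swap hγ (h.left_notMem hu) (h.right_notMem hv)]
    have := h.index_eq u hu v hv
    lia

theorem notMem_right (h : AreSides γ U V) {z : Sphere2} (hz : z ∈ U) : z ∉ V :=
  Set.disjoint_left.1 h.disjoint hz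

theorem ne (h : AreSides γ U V) {u v : Sphere2} (hu : u ∈ U) (hv : v ∈ V) : u ≠ v :=
  fun e => h.notMem_right hu (e ▸ hv)

end AreSides

section Retraction

variable {γ : Circle → Sphere2} {U V : Set Sphere2}

theorem exists_continuousOn_circle {X : Type*} [TopologicalSpace X] {s : Set X} {k : X → ℂ}
    (hk : ContinuousOn k s) (hk0 : ∀ x ∈ s, k x ≠ 0) :
    ∃ κ : X → Circle, ContinuousOn κ s ∧ ∀ x ∈ s, (κ x : ℂ) = k x / ‖k x‖ := by
  have hunit : ∀ x, ∃ c : Circle, x ∈ s → (c : ℂ) = k x / ‖k x‖ := fun x => by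
    by_cases hx : x ∈ s
    · refine ⟨⟨k x / ‖k x‖, ?_⟩, fun _ => rfl⟩
      simp [Submonoid.unitSphere, hk0 x hx]
    · exact ⟨1, fun h => absurd h hx⟩
  choose κ hκ using hunit
  refine ⟨κ, ?_, hκ⟩
  exact (⟨rfl⟩ : Topology.IsInducing ((↑) : Circle → ℂ)).continuousOn_iff.2 <|
    (hk.div (continuous_ofReal.comp_continuousOn hk.norm) fun x hx =>
      ofReal_ne_zero.2 (norm_ne_zero_iff.2 (hk0 x hx))).congr hκ

theorem exists_leftInverse_of_index (hγ : Continuous γ) (hi : Function.Injective γ)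
    {p q : Sphere2} (hp : p ∉ Set.range γ) (hq : q ∉ Set.range γ)
    (hindex : index γ p q = 1 ∨ index γ p q = -1) :
    ∃ κ : Sphere2 → Circle, ContinuousOn κ {p, q}ᶜ ∧ Function.LeftInverse κ γ := by
  set ε := index γ p q with hε
  have hεε : ε * ε = 1 := by rcases hindex with h | h <;> simp [h]
  have hwinding := (hasWindingNumber_index hγ hp hq).mul (hasWindingNumber_exp.zpow (-ε))
  rw [← hε, mul_one, add_neg_cancel] at hwinding
  obtain ⟨ℓ, hℓ, hℓγ⟩ := exists_log_extension hγ hi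
    (c := fun z => mobius p q (γ z) * (z : ℂ) ^ (-ε))
    (by simpa only [Circle.coe_exp] using hwinding)
  set k : Sphere2 → ℂ := fun x => (mobius p q x * exp (-ℓ x)) ^ ε
  have hkγ : ∀ z : Circle, k (γ z) = z := fun z => by
    have hne := mobius_ne_zero (ne_of_notMem_range hp z) (ne_of_notMem_range hq z)
    simp only [k, Complex.exp_neg, ← hℓγ, mul_inv_rev, zpow_neg, inv_inv]
    rw [mul_comm, inv_mul_cancel_right₀ hne, ← zpow_mul, hεε, zpow_one]
  have hfactor : ∀ x ∈ ({p, q}ᶜ : Set Sphere2), mobius p q x * exp (-ℓ x) ≠ 0 := fun x hx =>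
    mul_ne_zero (mobius_ne_zero (fun h => hx (Or.inl h)) fun h => hx (Or.inr h)) (exp_ne_zero _)
  have hk : ContinuousOn k {p, q}ᶜ := fun x hx =>
    (((continuousAt_mobius fun h => hx (Or.inr h)).mul hℓ.continuousAt.neg.cexp).zpow₀ _
      (Or.inl (hfactor x hx))).continuousWithinAt
  obtain ⟨κ, hκ, hκk⟩ := exists_continuousOn_circle hk fun x hx => zpow_ne_zero _ (hfactor x hx)
  refine ⟨κ, hκ, fun z => Circle.ext ?_⟩
  have hz : γ z ∈ ({p, q}ᶜ : Set Sphere2) := by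
    rintro (h | h)
    exacts [hp ⟨z, h⟩, hq ⟨z, h⟩]
  rw [hκk _ hz, hkγ, Circle.norm_coe, ofReal_one, div_one]

theorem AreSides.exists_retraction (h : AreSides γ U V) (hγ : Continuous γ)
    (hi : Function.Injective γ) {p q : Sphere2} (hp : p ∈ U) (hq : q ∈ V) :
    ∃ r : Sphere2 → Sphere2, ContinuousOn r {q}ᶜ ∧ Set.EqOn r id Vᶜ ∧
      (∀ z, r z ∉ V) ∧ ∀ z, r z = p → z = p := by
  obtain ⟨κ, hκ, hκγ⟩ := exists_leftInverse_of_index hγ hi (h.left_notMem hp) (h.right_notMem hq)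
    (h.index_eq p hp q hq)
  obtain ⟨r, hr, hrV, hrU⟩ := exists_continuousOn_eqOn_compl (s := {q}ᶜ) (f := id)
    (g := fun z => γ (κ z)) h.isOpen_left h.isOpen_right h.disjoint continuousOn_id
    (hγ.comp_continuousOn (hκ.mono fun z hz hz' => hz'.elim (fun e => hz.2 (e ▸ hp)) hz.1))
    (fun z hz => by
      rw [h.union_eq, compl_compl] at hz
      obtain ⟨x, rfl⟩ := hz
      exact congrArg γ (hκγ x).symm)
  refine ⟨r, hr, hrV, fun z hrz => ?_, fun z hrz => ?_⟩
  · by_cases hz : z ∈ V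
    · rw [hrU fun hzU => h.notMem_right hzU hz] at hrz
      exact h.right_notMem hrz ⟨_, rfl⟩
    · rw [hrV hz] at hrz
      exact hz hrz
  · by_cases hz : z ∈ V
    · rw [hrU fun hzU => h.notMem_right hzU hz] at hrz
      exact absurd ⟨_, hrz⟩ (h.left_notMem hp)
    · exact (hrV hz).symm.trans hrz

end Retraction

theorem eq_of_comp_eq {X Y A : Type*} [TopologicalSpace X] [TopologicalSpace Y]
    [TopologicalSpace A] [PreconnectedSpace A] {f : X → Y} {s : Set Y} (hf : IsCoveringMapOn f s)
    {g h : A → X} (hg : Continuous g) (hh : Continuous h) (he : ∀ a, f (g a) = f (h a))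
    (hs : ∀ a, f (g a) ∈ s) {a₀ : A} (ha₀ : g a₀ = h a₀) (a : A) : g a = h a := by
  have hs' : ∀ a, f (h a) ∈ s := fun a => he a ▸ hs a
  have heq := hf.isCoveringMap_restrictPreimage.eq_of_comp_eq
    (g₁ := fun a => ⟨g a, hs a⟩) (g₂ := fun a => ⟨h a, hs' a⟩) (by fun_prop) (by fun_prop)
    (funext fun a => Subtype.ext (he a)) a₀ (Subtype.ext ha₀)
  exact congrArg Subtype.val (congrFun heq a)

theorem subset_interior_of_isPreconnected {X : Type*} [TopologicalSpace X] {s t : Set X}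
    (hs : IsPreconnected s) (hst : Disjoint s (frontier t)) (hne : (s ∩ t).Nonempty) :
    s ⊆ interior t := by
  obtain ⟨x, hxs, hxt⟩ := hne
  have hfrontier : ∀ y ∈ s, y ∈ closure t → y ∈ interior t := fun y hys hyt =>
    by_contra fun hy => Set.disjoint_left.1 hst hys ⟨hyt, hy⟩
  exact hs.subset_left_of_subset_union isOpen_interior isClosed_closure.isOpen_compl
    (disjoint_compl_right.mono_left interior_subset_closure)
    (fun y hy => or_iff_not_imp_right.2 fun hyt => hfrontier y hy (not_not.1 hyt))
    ⟨x, hxs, hfrontier x hxs (subset_closure hxt)⟩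

theorem tendsto_of_tendsto_comp {α X Y : Type*} [TopologicalSpace X] [TopologicalSpace Y]
    [T2Space Y] {f : X → Y} (hf : Continuous f) {g : α → X} {l : Filter α} {K : Set X}
    (hK : IsCompact K) (hg : ∀ᶠ a in l, g a ∈ K) {x : X} (hx : ∀ z ∈ K, f z = f x → z = x)
    (hfg : Tendsto (fun a => f (g a)) l (𝓝 (f x))) : Tendsto g l (𝓝 x) :=
  hK.le_nhds_of_unique_clusterPt hg fun z hzK hz =>
    hx z hzK (eq_of_nhds_neBot (hz.map hf.continuousAt (tendsto_map' hfg)))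

theorem exists_lift_tendsto {X Y : Type*} [TopologicalSpace X] [T2Space X]
    [LocallyCompactSpace X] [TopologicalSpace Y] [T2Space Y] {f : X → Y} {s : Set Y} {Φ : ℂ → Y}
    (hf : Continuous f) (hopen : IsOpenMap f) (hcov : IsCoveringMapOn f s) (hΦ : Continuous Φ)
    (hΦs : ∀ w ≠ 0, Φ w ∈ s) {x : X} (hx : f x = Φ 0) (hiso : ∀ᶠ z in 𝓝[≠] x, f z ≠ f x) :
    ∃ Ψ : ℂ → X, Continuous Ψ ∧ (∀ ζ, f (Ψ ζ) = Φ (exp ζ)) ∧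
      Tendsto Ψ (comap re atBot) (𝓝 x) := by
  obtain ⟨K, hK, hKx, hKc⟩ := local_compact_nhds (eventually_nhdsWithin_iff.1 hiso)
  have huniq : ∀ z ∈ K, f z = f x → z = x := fun z hz hfz =>
    by_contra fun hne => hKx hz hne hfz
  have hfrontier : f x ∉ f '' frontier K := by
    rintro ⟨z, hz, hzx⟩
    refine hz.2 (?_ : z ∈ interior K)
    rw [huniq z (hKc.isClosed.frontier_subset hz) hzx]
    exact mem_interior_iff_mem_nhds.2 hK
  have hclosed : IsClosed (f '' frontier K) :=
    ((hKc.of_isClosed_subset isClosed_frontier hKc.isClosed.frontier_subset).image hf).isClosed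
  have hlim : Tendsto (fun ζ => Φ (exp ζ)) (comap re atBot) (𝓝 (f x)) :=
    hx ▸ (hΦ.tendsto 0).comp tendsto_exp_comap_re_atBot
  obtain ⟨M, hM⟩ := eventually_atBot.1 (eventually_comap.1 (hlim.eventually
    (inter_mem (hclosed.isOpen_compl.mem_nhds hfrontier) (hopen.image_mem_nhds hK))))
  have hhalf : ∀ ζ ∈ {ζ : ℂ | ζ.re ≤ M}, Φ (exp ζ) ∈ (f '' frontier K)ᶜ ∩ f '' K :=
    fun ζ hζ => hM ζ.re hζ ζ rfl
  have hMM : (M : ℂ) ∈ {ζ : ℂ | ζ.re ≤ M} := (ofReal_re M).le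
  obtain ⟨y, hyK, hy⟩ := (hhalf M hMM).2
  obtain ⟨Ψ, ⟨hΨM, hfΨ⟩, -⟩ := hcov.existsUnique_continuousMap_lifts
    ⟨fun ζ => Φ (exp ζ), by fun_prop⟩ (a₀ := (M : ℂ)) (e₀ := y) hy fun ζ => hΦs _ (exp_ne_zero ζ)
  replace hfΨ : ∀ ζ, f (Ψ ζ) = Φ (exp ζ) := congrFun hfΨ
  have hΨK : Ψ '' {ζ | ζ.re ≤ M} ⊆ interior K := by
    refine subset_interior_of_isPreconnected ((convex_halfSpace_re_le M).isPreconnected.image Ψ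
      Ψ.continuous.continuousOn) (Set.disjoint_left.2 ?_) ⟨y, ⟨M, hMM, hΨM⟩, hyK⟩
    rintro _ ⟨ζ, hζ, rfl⟩ hΨζ
    exact (hhalf ζ hζ).1 ⟨Ψ ζ, hΨζ, hfΨ ζ⟩
  have htail : ∀ᶠ ζ in comap re atBot, Ψ ζ ∈ K :=
    (tendsto_comap.eventually (eventually_le_atBot M)).mono fun ζ hζ =>
      interior_subset (hΨK ⟨ζ, hζ, rfl⟩)
  exact ⟨Ψ, Ψ.continuous, hfΨ, tendsto_of_tendsto_comp hf hKc htail huniq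
    (hlim.congr fun ζ => (hfΨ ζ).symm)⟩

namespace IsBranchedCovering

variable {f : Sphere2 → Sphere2}

theorem isOpenMap (hf : IsBranchedCovering f) : IsOpenMap f := by
  refine isOpenMap_iff_nhds_le.2 fun p A hA => ?_
  obtain ⟨d, φ, ψ, hd, -, -, hp, hfp, hφ, hψ, hloc⟩ := hf.2 p
  have himage : φ '' (φ.source ∩ f ⁻¹' A) ∈ 𝓝 (0 : ℂ) := by
    rw [← hφ, ← φ.map_nhds_eq hp]
    exact image_mem_map (inter_mem (φ.open_source.mem_nhds hp) hA)
  obtain ⟨r, hr, hball⟩ := Metric.mem_nhds_iff.1 himage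
  have hpreimage : ψ ⁻¹' Metric.ball 0 (r ^ d) ∈ 𝓝 (f p) :=
    ψ.continuousAt hfp (hψ ▸ Metric.ball_mem_nhds _ (by positivity))
  filter_upwards [hpreimage, ψ.open_source.mem_nhds hfp] with y hy hys
  obtain ⟨ζ, hζ⟩ : ∃ ζ : ℂ, ζ ^ d = ψ y := ⟨_, cpow_nat_inv_pow _ (by lia)⟩
  have hζr : ζ ∈ Metric.ball (0 : ℂ) r := by
    rw [Set.mem_preimage, mem_ball_zero_iff, ← hζ, norm_pow] at hy
    exact mem_ball_zero_iff.2 (lt_of_pow_lt_pow_left₀ d hr.le hy)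
  obtain ⟨x, ⟨hxs, hxA⟩, hx⟩ := hball hζr
  obtain ⟨hfx, hpow⟩ := hloc x hxs
  rw [hx, hζ] at hpow
  exact ψ.injOn hfx hys hpow ▸ hxA

theorem eventually_ne (hf : IsBranchedCovering f) (x : Sphere2) :
    ∀ᶠ y in 𝓝[≠] x, f y ≠ f x := by
  obtain ⟨d, φ, ψ, hd, -, -, hp, -, hφ, hψ, hloc⟩ := hf.2 x
  filter_upwards [self_mem_nhdsWithin, nhdsWithin_le_nhds (φ.open_source.mem_nhds hp)]
    with y hy hys h
  have hpow := (hloc y hys).2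
  rw [h, hψ] at hpow
  exact hy (φ.injOn hys hp (hφ ▸ (pow_eq_zero_iff (by lia)).1 hpow.symm))

theorem surjective (hf : IsBranchedCovering f) : Function.Surjective f :=
  Set.range_eq_univ.1 (IsClopen.eq_univ ⟨hf.1.isClosedMap.isClosed_range,
    hf.isOpenMap.isOpen_range⟩ (Set.range_nonempty f))

end IsBranchedCovering

section Postcritical

variable {f : Sphere2 → Sphere2}

theorem exists_injOn_of_notMem {x : Sphere2} (hx : f x ∉ postcriticalSet f) :
    ∃ N ∈ 𝓝 x, Set.InjOn f N := by
  by_contra! hc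
  exact hx (Set.mem_iUnion₂.2 ⟨1, le_rfl, x, hc, rfl⟩)

theorem map_mem_postcriticalSet {x : Sphere2} (hx : x ∈ postcriticalSet f) :
    f x ∈ postcriticalSet f := by
  obtain ⟨n, -, c, hc, rfl⟩ := Set.mem_iUnion₂.1 hx
  exact Set.mem_iUnion₂.2 ⟨n + 1, by lia, c, hc, Function.iterate_succ_apply' f n c⟩

theorem IsBranchedCovering.isCoveringMapOn (hf : IsBranchedCovering f) :
    IsCoveringMapOn f (postcriticalSet f)ᶜ := by
  refine IsCoveringMapOn.of_isLocalHomeomorphOn hf.1 (IsLocalHomeomorphOn.mk f _ fun x hx => ?_)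
  obtain ⟨N, hN, hinj⟩ := exists_injOn_of_notMem hx
  obtain ⟨O, hON, hO, hxO⟩ := mem_nhds_iff.1 hN
  exact ⟨OpenPartialHomeomorph.ofContinuousOpen ((hinj.mono hON).toPartialEquiv f O)
    hf.1.continuousOn hf.isOpenMap hO, hxO, fun y _ => rfl⟩

end Postcritical

/-- The closed curve `δ` parametrizes the full preimage of the curve `γ` under `f`, and `θ`
describes `f` on it in terms of the angles along `δ` and `γ`. -/
structure IsPreimageCurve (f : Sphere2 → Sphere2) (γ δ : Circle → Sphere2) (θ : ℝ → ℝ) :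
    Prop where
  continuous : Continuous δ
  range_eq : Set.range δ = f ⁻¹' Set.range γ
  continuous_angle : Continuous θ
  map_eq : ∀ t, f (δ (Circle.exp t)) = γ (Circle.exp (θ t))

section Fiber

variable {f : Sphere2 → Sphere2} {γ δ : Circle → Sphere2} {θ : ℝ → ℝ}

theorem AreSides.exists_continuous_extension {U V : Set Sphere2} (h : AreSides γ U V)
    (hγ : Continuous γ) (hi : Function.Injective γ) {p : Sphere2} (hp : p ∈ U) :
    ∃ (Φ : ℂ → Sphere2) (L : ℝ → ℂ) (n : ℤ), Continuous Φ ∧ Φ 0 = p ∧ (∀ w ≠ 0, Φ w ≠ p) ∧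
      (∀ w, Φ w ∉ V) ∧ Continuous L ∧ (∀ t, L (t + 2 * Real.pi) = L t + 2 * Real.pi * n * I) ∧
      ∀ t, Φ (exp (L t)) = γ (Circle.exp t) := by
  obtain ⟨q, hq⟩ := h.isConnected_right.nonempty
  have hpq := h.ne hp hq
  obtain ⟨r, hr, hrid, hrV, hrp⟩ := h.exists_retraction hγ hi hp hq
  obtain ⟨L, hL, hLexp, hLn⟩ := hasWindingNumber_index hγ (h.left_notMem hp) (h.right_notMem hq)
  refine ⟨fun w => r (mobiusInv p q w), L, _,
    hr.comp_continuous (continuous_mobiusInv hpq) (mobiusInv_ne_right hpq), ?_,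
    fun w hw hwp => mobiusInv_ne_left hpq hw (hrp _ hwp), fun w => hrV _, hL, hLn, fun t => ?_⟩
  · simp only [mobiusInv_zero, hrid (h.notMem_right hp), id]
  · simp only [← hLexp, mobiusInv_mobius hpq (ne_of_notMem_range (h.right_notMem hq) _)]
    exact hrid fun hV => h.right_notMem hV ⟨_, rfl⟩

theorem IsPreimageCurve.exists_int_lift (h : IsPreimageCurve f γ δ θ)
    (hi : Function.Injective γ) {s : Set Sphere2} (hcov : IsCoveringMapOn f s)
    (hγs : Set.range γ ⊆ s) {Φ : ℂ → Sphere2} {L : ℝ → ℂ} {n : ℤ} (hL : Continuous L)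
    (hLn : ∀ t, L (t + 2 * Real.pi) = L t + 2 * Real.pi * n * I)
    (hΦL : ∀ t, Φ (exp (L t)) = γ (Circle.exp t)) {Ψ : ℂ → Sphere2} (hΨ : Continuous Ψ)
    (hfΨ : ∀ ζ, f (Ψ ζ) = Φ (exp ζ)) :
    ∃ j : ℤ, ∀ t, Ψ (L (θ t) + 2 * Real.pi * j * I) = δ (Circle.exp t) := by
  obtain ⟨c, hc⟩ : Ψ (L (θ 0)) ∈ Set.range δ := by
    rw [h.range_eq, Set.mem_preimage, hfΨ, hΦL]
    exact ⟨_, rfl⟩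
  obtain ⟨τ, rfl⟩ := Circle.exp_surjective c
  have hγτ : γ (Circle.exp (θ 0)) = γ (Circle.exp (θ τ)) := by
    rw [← hΦL, ← hfΨ, ← hc, h.map_eq]
  obtain ⟨m, hm⟩ := Circle.exp_eq_exp.1 (hi hγτ)
  have hθ := h.continuous_angle
  have hδ := h.continuous
  have hmap : ∀ t, f (Ψ (L (θ t) + 2 * Real.pi * (m * n : ℤ) * I)) = f (δ (Circle.exp t)) :=
    fun t => by rw [hfΨ, exp_add_two_pi_mul_int_mul_I, hΦL, h.map_eq]
  refine ⟨m * n, eq_of_comp_eq hcov (by fun_prop) (by fun_prop) hmap (fun t => hγs ?_)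
    (a₀ := τ) ?_⟩
  · rw [hmap, h.map_eq]
    exact ⟨_, rfl⟩
  · rw [← add_int_mul_two_pi hLn m, ← hm, hc]

theorem tendsto_add_two_pi_mul_int_mul_I (j : ℤ) :
    Tendsto (fun ζ : ℂ => ζ + 2 * Real.pi * j * I) (comap re atBot) (comap re atBot) :=
  tendsto_comap_iff.2 (by simpa [Function.comp_def] using tendsto_comap)

/-- The curve `δ` is connected, so it meets the lifts of the exponential parametrization of
`U \ {p}` that end at two given preimages of `p`; hence these lifts are translates of each other. -/
theorem IsBranchedCovering.subsingleton_fiber (hf : IsBranchedCovering f) (hγ : Continuous γ)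
    (hi : Function.Injective γ) (hδ : IsPreimageCurve f γ δ θ)
    (hγP : Disjoint (Set.range γ) (postcriticalSet f)) {U V : Set Sphere2}
    (h : AreSides γ U V) {p : Sphere2} (hp : p ∈ U) (hPU : postcriticalSet f ∩ U ⊆ {p}) :
    (f ⁻¹' {p}).Subsingleton := by
  obtain ⟨Φ, L, n, hΦ, hΦ0, hΦp, hΦV, hL, hLn, hΦL⟩ := h.exists_continuous_extension hγ hi hp
  have hcov := hf.isCoveringMapOn
  have hγP' : Set.range γ ⊆ (postcriticalSet f)ᶜ := hγP.subset_compl_right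
  have hΦP : ∀ w ≠ 0, Φ w ∈ (postcriticalSet f)ᶜ := fun w hw => by
    by_cases hU : Φ w ∈ U
    · exact fun hP => hΦp w hw (hPU ⟨hP, hU⟩)
    · exact hγP' (not_not.1 fun hΦγ => (h.mem_or_mem_iff.2 hΦγ).elim hU (hΦV w))
  have hlift : ∀ x ∈ f ⁻¹' {p}, ∃ Ψ : ℂ → Sphere2, Continuous Ψ ∧
      (∀ ζ, f (Ψ ζ) = Φ (exp ζ)) ∧ Tendsto Ψ (comap re atBot) (𝓝 x) := fun x hx =>
    exists_lift_tendsto hf.1 hf.isOpenMap hcov hΦ hΦP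
      ((Set.mem_singleton_iff.1 hx).trans hΦ0.symm) (hf.eventually_ne x)
  intro x₁ hx₁ x₂ hx₂
  obtain ⟨Ψ₁, hΨ₁, hfΨ₁, hlim₁⟩ := hlift x₁ hx₁
  obtain ⟨Ψ₂, hΨ₂, hfΨ₂, hlim₂⟩ := hlift x₂ hx₂
  obtain ⟨j₁, hj₁⟩ := hδ.exists_int_lift hi hcov hγP' hL hLn hΦL hΨ₁ hfΨ₁
  obtain ⟨j₂, hj₂⟩ := hδ.exists_int_lift hi hcov hγP' hL hLn hΦL hΨ₂ hfΨ₂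
  have heq : ∀ ζ, Ψ₁ (ζ + 2 * Real.pi * j₁ * I) = Ψ₂ (ζ + 2 * Real.pi * j₂ * I) :=
    eq_of_comp_eq hcov (by fun_prop) (by fun_prop)
      (fun ζ => by simp only [hfΨ₁, hfΨ₂, exp_add_two_pi_mul_int_mul_I])
      (fun ζ => hfΨ₁ _ ▸ hΦP _ (exp_ne_zero _)) ((hj₁ 0).trans (hj₂ 0).symm)
  have : (comap re atBot).NeBot := NeBot.comap_of_surj inferInstance re_surjective
  exact tendsto_nhds_unique (hlim₁.comp (tendsto_add_two_pi_mul_int_mul_I j₁))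
    ((hlim₂.comp (tendsto_add_two_pi_mul_int_mul_I j₂)).congr fun ζ => (heq ζ).symm)

end Fiber

section LocalDegree

variable {f : Sphere2 → Sphere2} {x y q : Sphere2} {d : ℤ}

theorem tendsto_mobiusInv_nhdsNE (h : x ≠ y) : Tendsto (mobiusInv x y) (𝓝[≠] 0) (𝓝[≠] x) :=
  tendsto_nhdsWithin_iff.2 ⟨by
    simpa using ((continuous_mobiusInv h).tendsto 0).mono_left nhdsWithin_le_nhds,
    eventually_nhdsWithin_of_forall fun _ => mobiusInv_ne_left h⟩

theorem exists_stdParam_eq_mobiusInv (x : Sphere2) :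
    ∃ v, x ≠ v ∧ ∀ w, stdParam x w = mobiusInv x v (-w) := by
  induction x using OnePoint.rec with
  | infty =>
    refine ⟨(0 : ℂ), OnePoint.infty_ne_coe _, fun w => ?_⟩
    change (if w = 0 then OnePoint.infty else ((w⁻¹ : ℂ) : Sphere2)) = _
    simp [mobiusInv, ofHom]
  | coe a =>
    refine ⟨OnePoint.infty, OnePoint.coe_ne_infty _, fun w => ?_⟩
    change ((a + w : ℂ) : Sphere2) = _
    simp [mobiusInv, ofHom]

theorem HasLocalDegree.comp_mobiusInv {g : Sphere2 → ℂ}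
    (hg : HasLocalDegree (fun w => g (stdParam x w)) d) (h : x ≠ y) :
    HasLocalDegree (fun w => g (mobiusInv x y w)) d := by
  obtain ⟨v, hv, hstd⟩ := exists_stdParam_eq_mobiusInv x
  set u : ℂ → ℂ := fun w => -mobius y v (mobiusInv x y w)
  have hne : ∀ᶠ w in 𝓝 0, mobiusInv x y w ≠ v :=
    (continuous_mobiusInv h).continuousAt.eventually_ne (by simpa using hv)
  have hu : ∀ᶠ w in 𝓝 0, ContinuousAt u w := hne.mono fun w hw =>
    ((continuousAt_mobius hw).comp (continuous_mobiusInv h).continuousAt).neg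
  have hcoord : ∀ w, w * u w = -mobius x v (mobiusInv x y w) := fun w => by
    rw [← mobius_mul (mobiusInv_ne_right h w), mobius_mobiusInv h, mul_neg]
  have hw0 : Tendsto (fun w => w * u w) (𝓝[≠] 0) (𝓝[≠] 0) := by
    refine tendsto_nhdsWithin_iff.2 ⟨?_, ?_⟩
    · have hc : ContinuousAt (fun w => w * u w) 0 := continuousAt_id.mul hu.self_of_nhds
      simpa using hc.tendsto.mono_left nhdsWithin_le_nhds
    · filter_upwards [self_mem_nhdsWithin, nhdsWithin_le_nhds hne] with w hw hwv
      exact mul_ne_zero hw (neg_ne_zero.2 (mobius_ne_zero (mobiusInv_ne_right h w) hwv))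
  have hone : HasLocalDegree (fun w => w * u w) 1 :=
    hasLocalDegree_id_mul hu (neg_ne_zero.2 (by simpa using mobius_ne_zero h hv))
  refine mul_one d ▸ (hg.comp hone ?_ hw0).congr ?_
  · exact nhdsWithin_le_nhds (hu.mono fun w hw => continuousAt_id.mul hw)
  · filter_upwards [nhdsWithin_le_nhds hne] with w hw
    rw [hcoord, hstd, neg_neg, mobiusInv_mobius hv hw]

theorem IsOrientationPreserving.hasLocalDegree {φ : OpenPartialHomeomorph Sphere2 ℂ}
    (hφ : IsOrientationPreserving φ) (hx : x ∈ φ.source) (hφx : φ x = 0) (h : x ≠ y) :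
    HasLocalDegree (fun w => φ (mobiusInv x y w)) 1 := by
  obtain ⟨v, hv, hstd⟩ := exists_stdParam_eq_mobiusInv x
  have hcont : Continuous (stdParam x) := by
    rw [funext hstd]
    exact (continuous_mobiusInv hv).comp continuous_neg
  have hx0 : stdParam x 0 = x := by rw [hstd, neg_zero, mobiusInv_zero]
  have hsource : ∀ᶠ w in 𝓝 0, stdParam x w ∈ φ.source :=
    hcont.continuousAt.eventually (φ.open_source.mem_nhds (hx0.symm ▸ hx))
  obtain ⟨d, hd⟩ := exists_hasLocalDegree (g := fun w => φ (stdParam x w)) (by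
    filter_upwards [self_mem_nhdsWithin, nhdsWithin_le_nhds hsource] with w hw hws
    refine ⟨(φ.continuousAt hws).comp hcont.continuousAt, fun hφw => ?_⟩
    exact mobiusInv_ne_left hv (neg_ne_zero.2 hw)
      (hstd w ▸ φ.injOn hws hx (hφw.trans hφx.symm)))
  obtain ⟨r, hrd, hr⟩ := (hd.eventually_hasWindingNumber.and (hφ x hx)).exists
  simp only [hφx, sub_zero] at hr
  exact (hrd.unique hr ▸ hd).comp_mobiusInv h

theorem IsBranchedCovering.exists_hasLocalDegree (hf : IsBranchedCovering f) (h : x ≠ y)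
    (hq : f x ≠ q) :
    ∃ d : ℤ, 0 < d ∧ HasLocalDegree (fun w => mobius (f x) q (f (mobiusInv x y w))) d := by
  obtain ⟨d, φ, ψ, hd, hφ, hψ, hx, hfx, hφx, hψx, hloc⟩ := hf.2 x
  have hlim := tendsto_mobiusInv_nhdsNE h
  have hfq : ∀ᶠ w in 𝓝[≠] 0, f (mobiusInv x y w) ≠ q :=
    (hlim.mono_right nhdsWithin_le_nhds).eventually (hf.1.continuousAt.eventually_ne hq)
  have hcont : ∀ w, f (mobiusInv x y w) ≠ q →
      ContinuousAt (fun w => mobius (f x) q (f (mobiusInv x y w))) w := fun w hw =>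
    (continuousAt_mobius hw).comp (f := fun w => f (mobiusInv x y w))
      (hf.1.comp (continuous_mobiusInv h)).continuousAt
  have hpow : HasLocalDegree (fun w => φ (mobiusInv x y w) ^ d) d := by
    simpa using (hφ.hasLocalDegree hx hφx h).pow d
  refine ⟨d, by exact_mod_cast hd, (hψ.hasLocalDegree hfx hψx hq).of_comp_left
    (hpow.congr ?_) (hfq.mono hcont) (tendsto_nhdsWithin_iff.2 ⟨?_, ?_⟩)⟩
  · filter_upwards [hfq, (hlim.mono_right nhdsWithin_le_nhds).eventually
      (φ.open_source.mem_nhds hx)] with w hw hws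
    rw [mobiusInv_mobius hq hw, (hloc _ hws).2]
  · simpa using (hcont 0 (by simpa using hq)).tendsto.mono_left nhdsWithin_le_nhds
  · filter_upwards [hfq, hlim.eventually (hf.eventually_ne x)] with w hwq hwx
    exact mobius_ne_zero hwx hwq

end LocalDegree

section Sides

variable {f : Sphere2 → Sphere2} {γ δ : Circle → Sphere2} {θ : ℝ → ℝ} {U V U' V' : Set Sphere2}

namespace IsPreimageCurve

theorem mapsTo_side (hδ : IsPreimageCurve f γ δ θ) (hf : Continuous f) (h : AreSides γ U V)
    (h' : AreSides δ U' V') {x : Sphere2} (hx : x ∈ U') (hfx : f x ∈ U) : Set.MapsTo f U' U :=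
  h'.isConnected_left.isPreconnected.subset_left_of_subset_union (h.isOpen_left.preimage hf)
    (h.isOpen_right.preimage hf) (h.disjoint.preimage f)
    (fun _ hz => h.mem_or_mem_iff.2 fun hfz => h'.left_notMem hz (hδ.range_eq ▸ hfz))
    ⟨x, hx, hfx⟩

theorem exists_pos_int_angle_add (hδ : IsPreimageCurve f γ δ θ) (hi : Function.Injective γ)
    (hmono : StrictMono θ) :
    ∃ m : ℤ, 0 < m ∧ ∀ t, θ (t + 2 * Real.pi) = θ t + m * (2 * Real.pi) := by
  have hθ := hδ.continuous_angle
  obtain ⟨m, hm⟩ := exists_int_of_exp_eq_of_continuous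
    (A := fun t : ℝ => (θ (t + 2 * Real.pi) : ℂ) * I) (B := fun t : ℝ => (θ t : ℂ) * I)
    (by fun_prop) (by fun_prop) fun t => by
      simp only [← Circle.coe_exp]
      exact congrArg _ (hi (by rw [← hδ.map_eq, ← hδ.map_eq, Circle.exp_add_two_pi]))
  have hadd : ∀ t, θ (t + 2 * Real.pi) = θ t + m * (2 * Real.pi) := fun t => by
    refine ofReal_injective (mul_right_cancel₀ I_ne_zero ((hm t).trans ?_))
    push_cast; ring
  have hpos : 0 < m * (2 * Real.pi) := by
    have hlt := hmono (lt_add_of_pos_right 0 Real.two_pi_pos)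
    rwa [hadd, lt_add_iff_pos_right] at hlt
  exact ⟨m, by exact_mod_cast pos_of_mul_pos_left hpos Real.two_pi_pos.le, hadd⟩

end IsPreimageCurve

/-- Retracting the closed side of `δ` containing `x` turns `f` into a self-map of the plane whose
only zero is `x`, and there its degree is positive. -/
theorem IsBranchedCovering.index_eq (hf : IsBranchedCovering f) (hγ : Continuous γ)
    (hi : Function.Injective γ) (hδ : IsPreimageCurve f γ δ θ) (hδi : Function.Injective δ)
    (hθ : StrictMono θ) (h : AreSides γ U V) (h' : AreSides δ U' V') {x y q : Sphere2}
    (hx : x ∈ U') (hy : y ∈ V') (hfx : f x ∈ U) (hq : q ∈ V)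
    (hfib : (f ⁻¹' {f x}).Subsingleton) : index δ x y = index γ (f x) q := by
  have hxy := h'.ne hx hy
  obtain ⟨r, hr, hrid, hrV, hrx⟩ := h'.exists_retraction hδ.continuous hδi hx hy
  set R : ℂ → Sphere2 := fun w => f (r (mobiusInv x y w))
  have hRc : Continuous R :=
    hf.1.comp (hr.comp_continuous (continuous_mobiusInv hxy) (mobiusInv_ne_right hxy))
  have hRV : ∀ w, R w ∉ V := fun w hw => by
    by_cases hU : r (mobiusInv x y w) ∈ U'
    · exact h.notMem_right (hδ.mapsTo_side hf.1 h h' hx hfx hU) hw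
    · refine (h'.mem_or_mem_iff.2 fun hrδ => h.right_notMem hw ?_).elim hU (hrV _)
      exact (hδ.range_eq ▸ hrδ : _ ∈ f ⁻¹' Set.range γ)
  have hRq : ∀ w, R w ≠ q := fun w hw => hRV w (hw ▸ hq)
  have hRx : ∀ w ≠ 0, R w ≠ f x := fun w hw hR =>
    mobiusInv_ne_left hxy hw (hrx _ (hfib hR rfl))
  obtain ⟨d, hd, hdeg⟩ := hf.exists_hasLocalDegree hxy (h.ne hfx hq)
  have hnear : ∀ᶠ w in 𝓝[≠] 0, mobiusInv x y w ∈ U' := (tendsto_mobiusInv_nhdsNE hxy).eventually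
    (nhdsWithin_le_nhds (h'.isOpen_left.mem_nhds hx))
  replace hdeg : HasLocalDegree (fun w => mobius (f x) q (R w)) d :=
    hdeg.congr (hnear.mono fun w hw => by simp only [R, hrid (h'.notMem_right hw), id])
  have hwind := hdeg.hasWindingNumber_comp
    (continuous_mobius_comp hRc _ fun ⟨w, hw⟩ => hRq w hw).continuousOn
    (fun w hw => mobius_ne_zero (hRx w hw) (hRq w))
    (hasWindingNumber_index hδ.continuous (h'.left_notMem hx) (h'.right_notMem hy))
  have hRδ : ∀ t, R (mobius x y (δ (Circle.exp t))) = γ (Circle.exp (θ t)) := fun t => by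
    simp only [R, mobiusInv_mobius hxy (ne_of_notMem_range (h'.right_notMem hy) _)]
    rw [hrid fun hV => h'.right_notMem hV ⟨_, rfl⟩, id, hδ.map_eq]
  simp only [hRδ] at hwind
  obtain ⟨m, hm0, hm⟩ := hδ.exists_pos_int_angle_add hi hθ
  have hmul := hwind.unique ((hasWindingNumber_index hγ (h.left_notMem hfx)
    (h.right_notMem hq)).comp hδ.continuous_angle hm)
  rcases h.index_eq _ hfx _ hq with hγ1 | hγ1 <;> rcases h'.index_eq _ hx _ hy with hδ1 | hδ1 <;>
    rw [hγ1, hδ1] at hmul ⊢ <;> lia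

end Sides

section Fibers

variable {X Y : Type*} [TopologicalSpace X] [TopologicalSpace Y] {f : X → Y}

theorem isOpen_setOf_nontrivial_fiber [T2Space X] (hf : IsOpenMap f) :
    IsOpen {y | (f ⁻¹' {y}).Nontrivial} := by
  refine isOpen_iff_mem_nhds.2 ?_
  rintro _ ⟨x₁, rfl, x₂, hx₂, hne⟩
  obtain ⟨W₁, W₂, hW₁, hW₂, hx₁W, hx₂W, hd⟩ := t2_separation hne
  have h₂ := hf.image_mem_nhds (hW₂.mem_nhds hx₂W)
  rw [show f x₂ = f x₁ from hx₂] at h₂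
  filter_upwards [hf.image_mem_nhds (hW₁.mem_nhds hx₁W), h₂]
  rintro _ ⟨a, ha, rfl⟩ ⟨b, hb, hba⟩
  exact ⟨a, rfl, b, hba, hd.ne_of_mem ha hb⟩

theorem eventually_subsingleton_fiber (hf : IsClosedMap f) {x : X} {N : Set X} (hN : N ∈ 𝓝 x)
    (hinj : Set.InjOn f N) (hx : (f ⁻¹' {f x}).Subsingleton) :
    ∀ᶠ y in 𝓝 (f x), (f ⁻¹' {y}).Subsingleton := by
  have hfib : ∀ᶠ y in 𝓝 (f x), ∀ z ∈ f ⁻¹' {y}, z ∈ N :=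
    hf.eventually_nhds_fiber (f x) fun z hz => hx rfl hz ▸ hN
  exact hfib.mono fun y hy a ha b hb => hinj (hy a ha) (hy b hb) (Eq.trans ha (Eq.symm hb))

end Fibers

/-- Off the finite, hence non-separating, postcritical set, the one-point fibres form an open and
closed set. -/
theorem IsThurstonMap.not_forall_subsingleton {f : Sphere2 → Sphere2} (hf : IsThurstonMap f)
    {U : Set Sphere2} (hU : IsOpen U) (hne : U.Nonempty) :
    ¬ ∀ y ∈ U, (f ⁻¹' {y}).Subsingleton := fun hUs => by
  have hb := hf.isBranchedCovering
  have hB := isOpen_setOf_nontrivial_fiber hb.isOpenMap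
  have hA : IsOpen {y | (f ⁻¹' {y}).Subsingleton ∧ y ∉ postcriticalSet f} := by
    refine isOpen_iff_mem_nhds.2 ?_
    rintro y ⟨hy, hyP⟩
    obtain ⟨x, rfl⟩ := hb.surjective y
    obtain ⟨N, hN, hinj⟩ := exists_injOn_of_notMem hyP
    exact (eventually_subsingleton_fiber hb.1.isClosedMap hN hinj hy).and
      (hf.finite_postcriticalSet.isClosed.isOpen_compl.mem_nhds hyP)
  have hBne : ∃ y, (f ⁻¹' {y}).Nontrivial := by
    by_contra! hsub
    have hdeg : degree f ≤ 1 := iSup_le fun y => Set.encard_le_one_iff_subsingleton.2 (hsub y)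
    exact absurd (hf.two_le_degree.trans hdeg) (by norm_num)
  have hdense : Dense (postcriticalSet f)ᶜ := by
    rw [Set.compl_eq_univ_sdiff]
    exact dense_univ.sdiff_finite hf.finite_postcriticalSet
  obtain ⟨u, huU, huP⟩ := hdense.inter_open_nonempty U hU hne
  obtain ⟨b, hbB, hbP⟩ := hdense.inter_open_nonempty _ hB hBne
  obtain ⟨z, -, hzA, hzB⟩ := isPreconnected_compl_of_finite hf.finite_postcriticalSet _ _ hA hB
    (fun y hy => (Set.subsingleton_or_nontrivial _).imp_left fun hs => ⟨hs, hy⟩)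
    ⟨u, huP, hUs u huU, huP⟩ ⟨b, hbP, hbB⟩
  exact Set.not_subsingleton_iff.2 hzB hzA.1

namespace IsIsotopyRel

variable {H : unitInterval → Sphere2 ≃ₜ Sphere2} {P : Set Sphere2} {γ : Circle → Sphere2}
  {p q : Sphere2}

theorem notMem_range (hH : IsIsotopyRel H P) (hγP : Disjoint (Set.range γ) P) (hp : p ∈ P)
    (τ : unitInterval) : p ∉ Set.range fun z => H τ (γ z) := fun ⟨z, hz⟩ =>
  Set.disjoint_left.1 hγP ⟨z, (H τ).injective (hz.trans (hH.2.2 τ p hp).symm)⟩ hp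

theorem index_eq (hH : IsIsotopyRel H P) (hγ : Continuous γ) (hγP : Disjoint (Set.range γ) P)
    (hp : p ∈ P) (hq : q ∈ P) : index (fun z => H 1 (γ z)) p q = index γ p q := by
  have hHp := fun τ => ne_of_notMem_range (hH.notMem_range hγP hp τ)
  have hHq := fun τ => ne_of_notMem_range (hH.notMem_range hγP hq τ)
  refine ThurstonMap.index_eq (HasWindingNumber.homotopy
    (F := fun τ t => mobius p q (H τ (γ (Circle.exp t)))) ?_
    (fun τ t => mobius_ne_zero (hHp τ _) (hHq τ _)) (fun τ t => by simp [Circle.exp_add]) ?_)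
  · refine continuous_iff_continuousAt.2 fun x => (continuousAt_mobius (hHq x.1 _)).comp
      (f := fun x : unitInterval × ℝ => H x.1 (γ (Circle.exp x.2))) ?_
    exact (hH.1.comp (f := fun x : unitInterval × ℝ => (x.1, γ (Circle.exp x.2)))
      (by fun_prop)).continuousAt
  · simp only [hH.2.1]
    exact hasWindingNumber_index hγ (Set.disjoint_right.1 hγP hp) (Set.disjoint_right.1 hγP hq)

end IsIsotopyRel

theorem exists_areSides_of_index_ne_zero {δ : Circle → Sphere2} {p q : Sphere2}
    (hδ : Continuous δ) (hi : Function.Injective δ) (hp : p ∉ Set.range δ) (hq : q ∉ Set.range δ)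
    (hpq : index δ p q ≠ 0) : ∃ U V, AreSides δ U V ∧ p ∈ U ∧ q ∈ V := by
  have hside : ∀ {U V}, AreSides δ U V → p ∈ U → q ∈ V := fun h hpU =>
    (h.mem_or_mem_iff.2 hq).resolve_left fun hqU => hpq <|
      index_eq_zero_of_isPreconnected hδ h.isConnected_left.isPreconnected
        (fun _ => h.left_notMem) hpU hqU
  obtain ⟨U, V, h⟩ := exists_areSides hδ hi
  rcases h.mem_or_mem_iff.2 hp with hpU | hpV
  · exact ⟨U, V, h, hpU, hside h hpU⟩
  · exact ⟨V, U, h.symm hδ, hpV, hside (h.symm hδ) hpV⟩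

section Equator

variable {f : Sphere2 → Sphere2} {γ δ : Circle → Sphere2} {θ : ℝ → ℝ} {U V U' V' : Set Sphere2}
  {p q x : Sphere2}

theorem IsThurstonMap.nonempty_postcriticalSet_inter (hf : IsThurstonMap f) (hγ : Continuous γ)
    (hi : Function.Injective γ) (hδ : IsPreimageCurve f γ δ θ)
    (hγP : Disjoint (Set.range γ) (postcriticalSet f)) (h : AreSides γ U V) :
    (postcriticalSet f ∩ U).Nonempty := by
  by_contra! hempty
  refine hf.not_forall_subsingleton h.isOpen_left h.isConnected_left.nonempty fun p hp => ?_
  exact hf.isBranchedCovering.subsingleton_fiber hγ hi hδ hγP h hp (hempty ▸ Set.empty_subset _)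

/-- Let `p = f x`. If `x` were in `V'`, then `index δ x p = index γ p q` by orientation, whereas
`index δ x p = index δ q p = -index γ p q` because `δ` does not separate `x` from `q`. -/
theorem IsBranchedCovering.mem_side (hf : IsBranchedCovering f) (hγ : Continuous γ)
    (hi : Function.Injective γ) (hδ : IsPreimageCurve f γ δ θ) (hδi : Function.Injective δ)
    (hθ : StrictMono θ) (h : AreSides γ U V) (h' : AreSides δ U' V') (hp : f x ∈ U) (hq : q ∈ V)
    (hp' : f x ∈ U') (hq' : q ∈ V') (hindex : index δ (f x) q = index γ (f x) q)
    (hfib : (f ⁻¹' {f x}).Subsingleton) : x ∈ U' := by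
  have hxδ : x ∉ Set.range δ := fun hx =>
    h.left_notMem hp (hδ.range_eq ▸ hx : x ∈ f ⁻¹' Set.range γ)
  refine (h'.mem_or_mem_iff.2 hxδ).resolve_right fun hxV => ?_
  have hxq : index δ x q = 0 := index_eq_zero_of_isPreconnected hδ.continuous
    h'.isConnected_right.isPreconnected (fun _ => h'.right_notMem) hxV hq'
  have hadd := index_add hδ.continuous hxδ (h'.right_notMem hq') (h'.left_notMem hp')
  have hswap := index_swap hδ.continuous (h'.left_notMem hp') (h'.right_notMem hq')
  have heq := hf.index_eq hγ hi hδ hδi hθ h (h'.symm hδ.continuous) hxV hp' hp hq hfib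
  rcases h.index_eq _ hp _ hq with hγ1 | hγ1 <;> lia

theorem IsThurstonMap.isThurstonPolynomial (hf : IsThurstonMap f) (hγ : Continuous γ)
    (hi : Function.Injective γ) (hδ : IsPreimageCurve f γ δ θ) (hδi : Function.Injective δ)
    (hθ : StrictMono θ) (hγP : Disjoint (Set.range γ) (postcriticalSet f))
    (hδP : Disjoint (Set.range δ) (postcriticalSet f))
    (hindex : ∀ p ∈ postcriticalSet f, ∀ q ∈ postcriticalSet f, index δ p q = index γ p q)
    (h : AreSides γ U V) (hU : (postcriticalSet f ∩ U).Subsingleton) :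
    IsThurstonPolynomial f := by
  have hb := hf.isBranchedCovering
  obtain ⟨p, hpP, hp⟩ := hf.nonempty_postcriticalSet_inter hγ hi hδ hγP h
  obtain ⟨q, hqP, hq⟩ := hf.nonempty_postcriticalSet_inter hγ hi hδ hγP (h.symm hγ)
  have hfib : (f ⁻¹' {p}).Subsingleton :=
    hb.subsingleton_fiber hγ hi hδ hγP h hp fun z hz => hU hz ⟨hpP, hp⟩
  obtain ⟨x, rfl⟩ := hb.surjective p
  have hne : index δ (f x) q ≠ 0 := by
    rw [hindex _ hpP _ hqP]
    rcases h.index_eq _ hp _ hq with h1 | h1 <;> simp [h1]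
  obtain ⟨U', V', h', hp', hq'⟩ := exists_areSides_of_index_ne_zero hδ.continuous hδi
    (Set.disjoint_right.1 hδP hpP) (Set.disjoint_right.1 hδP hqP) hne
  have hx := hb.mem_side hγ hi hδ hδi hθ h h' hp hq hp' hq' (hindex _ hpP _ hqP) hfib
  have hfix : f (f x) = f x := hU
    ⟨map_mem_postcriticalSet hpP, hδ.mapsTo_side hb.1 h h' hx hp hp'⟩ ⟨hpP, hp⟩
  exact ⟨hf, f x, hfix, Set.eq_singleton_iff_unique_mem.2 ⟨hfix, fun z hz => hfib hz hfix⟩⟩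

end Equator

theorem subsingleton_inter_or_of_ncard_le_three {α : Type*} {P U V : Set α} (hP : P.Finite)
    (hcard : P.ncard ≤ 3) (hUV : Disjoint U V) :
    (P ∩ U).Subsingleton ∨ (P ∩ V).Subsingleton := by
  by_contra! hnot
  have hU : (P ∩ U).Finite := hP.subset Set.inter_subset_left
  have hV : (P ∩ V).Finite := hP.subset Set.inter_subset_left
  have hU2 := Set.one_lt_ncard_iff_nontrivial_and_finite.2 ⟨hnot.1, hU⟩
  have hV2 := Set.one_lt_ncard_iff_nontrivial_and_finite.2 ⟨hnot.2, hV⟩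
  have hadd := Set.ncard_union_eq
    (hUV.mono (Set.inter_subset_right (s := P)) (Set.inter_subset_right (s := P))) hU hV
  have hle := Set.ncard_le_ncard
    (Set.union_subset (Set.inter_subset_left (t := U)) (Set.inter_subset_left (t := V))) hP
  lia

end ThurstonMap

theorem mainTheorem6 (f : ThurstonMap.Sphere2 → ThurstonMap.Sphere2)
    (hf : ThurstonMap.IsThurstonMap f) (hpoly : ¬ ThurstonMap.IsThurstonPolynomial f)
    (hpost : (ThurstonMap.postcriticalSet f).ncard ≤ 3) :
    ¬ ThurstonMap.HasEquator f := by
  rintro ⟨_, γ, hγ, hi, rfl, hγP, -, H, hH, hHE, θ, hθ, hmono, hfθ⟩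
  have hδ : ThurstonMap.IsPreimageCurve f γ (fun z => H 1 (γ z)) θ :=
    ⟨(H 1).continuous.comp hγ, by rw [← hHE, ← Set.range_comp]; rfl, hθ, hfθ⟩
  have hδi : Function.Injective fun z => H 1 (γ z) := (H 1).injective.comp hi
  have hδP := Set.disjoint_right.2 fun p hp => hH.notMem_range hγP hp 1
  have hindex := fun p hp q hq => hH.index_eq (p := p) (q := q) hγ hγP hp hq
  obtain ⟨U, V, h⟩ := ThurstonMap.exists_areSides hγ hi
  rcases ThurstonMap.subsingleton_inter_or_of_ncard_le_three hf.finite_postcriticalSet hpost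
    h.disjoint with hU | hV
  · exact hpoly (hf.isThurstonPolynomial hγ hi hδ hδi hmono hγP hδP hindex h hU)
  · exact hpoly (hf.isThurstonPolynomial hγ hi hδ hδi hmono hγP hδP hindex (h.symm hγ) hV)
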